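/- All lattices are finite. The cover graph $C(P)$ of a finite poset $P$ has the elements of $P$ as vertices and the coverings $x\prec y$ as edges; the nullity of $P$ is (number of edges) $-$ (number of vertices) $+$ (number of connected components) of $C(P)$. In a poset $P$ let $\mathrm{Irr}(P)$ be the set of elements with at most one lower and at most one upper cover, $\mathrm{Irr}^*(P)$ the set of elements with exactly one lower and exactly one upper cover, and $\mathrm{Red}(P)=P\setminus\mathrm{Irr}(P)$. In a lattice, an element $a$ is meet-reducible (join-reducible) if $a=\inf\{b,c\}$ ($a=\sup\{b,c\}$) for some $b,c\neq a$, and reducible if it is one or the other. A block is a finite lattice whose largest element is join-reducible and whose smallest element is meet-reducible. An element $x\in\mathrm{Irr}(P)$ is retractible in $P$ if either there are no $y,z\in\mathrm{Red}(P)$ with $y\prec x\prec z$, or there are such $y,z$ and $y\prec x\prec z$ is the only directed path from $y$ to $z$ in the cover graph. A basic block associated to $P$ is a subposet obtained from $P$ by first successively removing elements of $\mathrm{Irr}^*$ that are retractible in the current subposet until there are none left, and then successively removing pendant vertices of the cover graph (vertices of degree one) until there are none left. The height of a poset is the maximal number of coverings in a chain. Let $\mathscr{B}(j;4,3,4)$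 be the class of all blocks, up to isomorphism, with $j$ elements, exactly four reducible elements, these being pairwise comparable, and nullity three, whose associated basic block has height four. For pairs $(a_k,b_k)$, $k=1,2,3$, of elements of the chain $0\prec1\prec2\prec3\prec4$ with $a_k<b_k$, let $[a_1b_1,a_2b_2,a_3b_3]$ be the poset consisting of this chain and three more elements $c_1,c_2,c_3$, where for chain elements $u,v$ one has $u\le c_k$ iff $u\le a_k$, $c_k\le v$ iff $b_k\le v$, and $c_k\le c_l$ iff $k=l$ or $b_k\le a_l$. Put $$B_4=[13,13,04],\quad B_5=[13,04,04],\quad B_6=[14,24,02],\quad B_7=[03,02,24],\quad B_8=[14,24,04],$$ $$B_9=[03,02,04],\quad B_{10}=[13,03,04],\quad B_{11}=[13,14,04],\quad B_{12}=[13,03,14].$$ For $4\le i\le 12$ let $\mathbb{B}_i(j;4,3)$ be the class of all blocks, up to isomorphism, with $j$ elements, exactly four reducible elements, these being pairwise comparable, and nullity three, whose associated basic block is isomorphic to $B_i$. Let $P_n^k$ be the number of partitions of $n$ into exactly $k$ positive integer parts. Theorem. For every integer $j\ge 8$, $$|\mathscr{B}(j;4,3,4)|=\sum_{i=4}^{12}|\mathbb{B}_i(j;4,3)|=\sum_{t=1}^{j-7}\sum_{i=2}^{j-t-5}(i-1)P^{3}_{j-t-i-2}+\sum_{p=4}^{j-4}\sum_{t=1}^{j-p-3}t\,P^{2}_{j-p-t-1}P^{2}_{p-2}+\sum_{t=1}^{j-7}\sum_{r=1}^{j-t-6}\sum_{l=1}^{j-t-r-5}\sum_{i=1}^{j-t-r-l-4}7P^{2}_{j-t-r-l-i-2}.$$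 -/

import Mathlib

/-! ### Cover relations, irreducible elements, nullity -/

section Poset

variable {α : Type*} [PartialOrder α]

/-- `x ∈ Irr(P)`: at most one lower cover and at most one upper cover. -/
def IsIrr (x : α) : Prop :=
  {y : α | y ⋖ x}.Subsingleton ∧ {y : α | x ⋖ y}.Subsingleton

/-- `x ∈ Irr*(P)`: exactly one lower cover and exactly one upper cover. -/
def IsIrrStar (x : α) : Prop :=
  (∃! y : α, y ⋖ x) ∧ ∃! y : α, x ⋖ y

/-- `x ∈ Red(P)`, the complement of `Irr(P)`. -/
def IsRed (x : α) : Prop := ¬ IsIrr x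

/-- A doubly irreducible element `x` is retractible if there are no reducible `y ⋖ x ⋖ z`, or there
are such `y`, `z` and `y, x, z` is the only directed path from `y` to `z` in the cover graph. -/
def IsRetractible (x : α) : Prop :=
  IsIrr x ∧
    ((¬ ∃ y z : α, IsRed y ∧ IsRed z ∧ y ⋖ x ∧ x ⋖ z) ∨
      ∃ y z : α, IsRed y ∧ IsRed z ∧ y ⋖ x ∧ x ⋖ z ∧
        ∀ l : List α, l.IsChain (· ⋖ ·) → l.head? = some y → l.getLast? = some z → l = [y, x, z])

/-- A pendant vertex of the cover graph. -/
def IsPendant (x : α) : Prop := ((SimpleGraph.hasse α).neighborSet x).ncard = 1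

variable (α) in
/-- No element of `Irr*(P)` is retractible. -/
def IsBasicRetract : Prop := ∀ x : α, IsIrrStar x → ¬ IsRetractible x

/-- The subposet `T` arises from the subposet `S` by removing one element of `Irr*(S)` that is
retractible in `S`. -/
def RetractStep (S T : Set α) : Prop :=
  ∃ x : S, IsIrrStar x ∧ IsRetractible x ∧ T = S \ {(x : α)}

/-- The subposet `T` arises from the subposet `S` by removing one pendant vertex of `S`. -/
def PendantStep (S T : Set α) : Prop :=
  ∃ x : S, IsPendant x ∧ T = S \ {(x : α)}

/-- `R` is a basic retract associated to the poset `α`. -/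
def IsAssociatedBasicRetract (R : Set α) : Prop :=
  Relation.ReflTransGen RetractStep Set.univ R ∧ IsBasicRetract R

/-- `B` is a basic block associated to the poset `α`: it is obtained from an associated basic
retract by successive removal of all pendant vertices. -/
def IsAssociatedBasicBlock (B : Set α) : Prop :=
  ∃ R : Set α, IsAssociatedBasicRetract R ∧ Relation.ReflTransGen PendantStep R B ∧
    ∀ x : B, ¬ IsPendant x

variable (α) in
/-- The basic block associated to `α` has height `h`, the length of its longest chains. -/
def HasBasicBlockOfHeight (h : ℕ) : Prop :=
  ∃ B : Set α, IsAssociatedBasicBlock B ∧ Order.krullDim B = (h : WithBot ℕ∞)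

variable (α) in
/-- The basic block associated to `α` is (isomorphic to) `β`. -/
def HasBasicBlock (β : Type*) [PartialOrder β] : Prop :=
  ∃ B : Set α, IsAssociatedBasicBlock B ∧ Nonempty (B ≃o β)

variable (α) in
/-- Nullity of the cover graph: number of edges minus number of vertices plus number of connected
components (for finite `α`). -/
noncomputable def nullity : ℤ :=
  ((SimpleGraph.hasse α).edgeSet.ncard : ℤ) - (Nat.card α : ℤ) +
    (Nat.card (SimpleGraph.hasse α).ConnectedComponent : ℤ)

end Poset

/-! ### Reducible elements of lattices, blocks -/

section Lattice

variable {α : Type*} [Lattice α]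

def IsMeetReducible (a : α) : Prop := ∃ b c : α, b ≠ a ∧ c ≠ a ∧ b ⊓ c = a

def IsJoinReducible (a : α) : Prop := ∃ b c : α, b ≠ a ∧ c ≠ a ∧ b ⊔ c = a

def IsReducible (a : α) : Prop := IsMeetReducible a ∨ IsJoinReducible a

variable (α) in
/-- The largest element is join-reducible and the smallest element is meet-reducible. -/
def IsBlock : Prop :=
  (∃ t : α, IsTop t ∧ IsJoinReducible t) ∧ ∃ b : α, IsBot b ∧ IsMeetReducible b

variable (α) in
/-- A block with exactly `r` reducible elements, which are pairwise comparable, and nullity `k`. -/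
def IsRCBlock (r k : ℕ) : Prop :=
  IsBlock α ∧ {a : α | IsReducible a}.ncard = r ∧ IsChain (· ≤ ·) {a : α | IsReducible a} ∧
    nullity α = (k : ℤ)

end Lattice

/-! ### The nine basic blocks of height four -/

/-- The adjunct pairs of `B₄, …, B₁₂` (in this order) over the chain `0 < 1 < 2 < 3 < 4`. -/
def adjunctPairs : Fin 9 → Fin 3 → Fin 5 × Fin 5 :=
  ![![(1, 3), (1, 3), (0, 4)],
    ![(1, 3), (0, 4), (0, 4)],
    ![(1, 4), (2, 4), (0, 2)],
    ![(0, 3), (0, 2), (2, 4)],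
    ![(1, 4), (2, 4), (0, 4)],
    ![(0, 3), (0, 2), (0, 4)],
    ![(1, 3), (0, 3), (0, 4)],
    ![(1, 3), (1, 4), (0, 4)],
    ![(1, 3), (0, 3), (1, 4)]]

theorem adjunctPairs_lt : ∀ i k, (adjunctPairs i k).1 < (adjunctPairs i k).2 := by decide

/-- The elements of `B_{i+4}`: a chain of five elements and three further elements `c_k`. -/
inductive HeightFourBlock (i : Fin 9) : Type
  | chain (u : Fin 5) : HeightFourBlock i
  | extra (k : Fin 3) : HeightFourBlock i

namespace HeightFourBlock

/-- The order of the iterated adjunct `C ]_{a₁}^{b₁} {c₁} ]_{a₂}^{b₂} {c₂} ]_{a₃}^{b₃} {c₃}`. -/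
def le (i : Fin 9) : HeightFourBlock i → HeightFourBlock i → Prop
  | chain u, chain v => u ≤ v
  | chain u, extra k => u ≤ (adjunctPairs i k).1
  | extra k, chain v => (adjunctPairs i k).2 ≤ v
  | extra k, extra l => k = l ∨ (adjunctPairs i k).2 ≤ (adjunctPairs i l).1

instance (i : Fin 9) : PartialOrder (HeightFourBlock i) where
  le := le i
  le_refl x := by cases x <;> simp [le]
  le_trans x y z := by
    have h := adjunctPairs_lt i
    rcases x with u | k <;> rcases y with v | l <;> rcases z with w | m <;> simp only [le] <;>
      grind
  le_antisymm x y := by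
    have h := adjunctPairs_lt i
    rcases x with u | k <;> rcases y with v | l <;> simp only [le] <;> grind

end HeightFourBlock

/-! ### Isomorphism classes of lattices on `j` elements -/

/-- Order isomorphism of lattice structures on `Fin j`. -/
def latticeSetoid (j : ℕ) : Setoid (Lattice (Fin j)) where
  r L M := Nonempty (@OrderIso (Fin j) (Fin j) L.toLE M.toLE)
  iseqv :=
    { refl := fun L => ⟨@OrderIso.refl (Fin j) L.toLE⟩
      symm := fun {L M} ⟨e⟩ => ⟨@OrderIso.symm (Fin j) (Fin j) L.toLE M.toLE e⟩
      trans := fun {L M N} ⟨e⟩ ⟨f⟩ =>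
        ⟨@OrderIso.trans (Fin j) (Fin j) (Fin j) L.toLE M.toLE N.toLE e f⟩ }

/-- Lattices on `j` elements up to isomorphism. -/
def LatticeClass (j : ℕ) : Type := Quotient (latticeSetoid j)

/-- `𝓑(j; r, k, h)`: the isomorphism classes of blocks on `j` elements with exactly `r` reducible
elements, all comparable, and nullity `k`, whose associated basic block has height `h`. -/
def blockClass (j r k h : ℕ) : Set (LatticeClass j) :=
  Quotient.mk (latticeSetoid j) '' {L | @IsRCBlock (Fin j) L r k ∧
    @HasBasicBlockOfHeight (Fin j) L.toPartialOrder h}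

/-- `𝔹_{i+4}(j; 4, 3)`: the isomorphism classes of blocks on `j` elements with exactly four
reducible elements, all comparable, and nullity three, whose associated basic block is `B_{i+4}`. -/
def typedBlockClass (i : Fin 9) (j : ℕ) : Set (LatticeClass j) :=
  Quotient.mk (latticeSetoid j) '' {L | @IsRCBlock (Fin j) L 4 3 ∧
    @HasBasicBlock (Fin j) L.toPartialOrder (HeightFourBlock i) _}

/-- `P_n^k`: the number of partitions of `n` into exactly `k` positive parts. -/
def numPartitions (k n : ℕ) : ℕ :=
  (Finset.univ.filter fun p : n.Partition => p.parts.card = k).card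

/-!
In a block whose reducible elements form a chain, every other element lies between two reducible
elements, and the irreducible elements between a given pair of them form disjoint chains
(*strands*). So the lattice is determined by the strand sizes over each pair of reducible elements
(a *gap*). One strand over a gap of consecutive reducible elements merely subdivides a cover; not
counting it, the nullity is the total number of strands, and the distribution of this *excess* over
the gaps is what makes the ends of the gaps reducible. Retraction shrinks every strand to a single
element and removes the subdividing ones, so basic blocks correspond to excess functions. For a
chain of `k` reducible elements, the basic block has height `k - 1` plus the number of consecutive
gaps with positive excess. For four nodes and total excess three, exactly one such gap gives height
four, and the nine solutions are `B₄, …, B₁₂`.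

It remains to count, over each gap, the multisets of positive strand sizes. A gap of excess `c`
contributes to the generating function the series of the partitions into `c` parts, into `c + 1`
parts if it is consecutive and `c > 0`, and `1 / (1 - X)` if it is consecutive and `c = 0`. With the
four nodes and two consecutive gaps without excess this leaves
`X ^ 4 / (1 - X) ^ 2` times `p₃ p₁`, `p₂ ^ 2` and, for the other seven types, `p₂ p₁ ^ 2`.
-/

/-! ### Covers in finite posets -/

section FinitePoset

variable {α β : Type*} [PartialOrder α] [PartialOrder β] {a b x y z : α}

theorem covBy_iff_eq_of_isGreatest_Iio (h : IsGreatest (Set.Iio x) y) : z ⋖ x ↔ z = y := by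
  have hyx : y ⋖ x := ⟨h.1, fun w hyw hwx => (h.2 hwx).not_gt hyw⟩
  refine ⟨fun hz => ?_, fun hz => hz ▸ hyx⟩
  exact (h.2 hz.lt).antisymm (not_lt_iff_le_imp_ge.1 (fun hlt => hz.2 hlt h.1) (h.2 hz.lt))

theorem covBy_iff_eq_of_isLeast_Ioi (h : IsLeast (Set.Ioi x) y) : x ⋖ z ↔ z = y := by
  rw [← toDual_covBy_toDual_iff]
  exact covBy_iff_eq_of_isGreatest_Iio (α := αᵒᵈ) h

theorem isIrrStar_of_isGreatest_of_isLeast (hy : IsGreatest (Set.Iio x) y)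
    (hz : IsLeast (Set.Ioi x) z) : IsIrrStar x := by
  simp only [IsIrrStar, covBy_iff_eq_of_isGreatest_Iio hy, covBy_iff_eq_of_isLeast_Ioi hz,
    existsUnique_eq, and_self]

theorem IsIrrStar.isIrr (h : IsIrrStar x) : IsIrr x :=
  ⟨fun _ hy _ hz => h.1.unique hy hz, fun _ hy _ hz => h.2.unique hy hz⟩

theorem not_subsingleton_lowerCovers [Finite α] (ha : a < x) (hb : b < x)
    (hx : ∀ z, a ≤ z → b ≤ z → ¬ z < x) : ¬ {y | y ⋖ x}.Subsingleton := by
  obtain ⟨a', ha', hax⟩ := exists_le_covBy_of_lt ha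
  obtain ⟨b', hb', hbx⟩ := exists_le_covBy_of_lt hb
  intro h
  obtain rfl : a' = b' := h hax hbx
  exact hx a' ha' hb' hax.lt

theorem not_subsingleton_upperCovers [Finite α] (ha : x < a) (hb : x < b)
    (hx : ∀ z, z ≤ a → z ≤ b → ¬ x < z) : ¬ {y | x ⋖ y}.Subsingleton := by
  obtain ⟨a', hxa, ha'⟩ := exists_covBy_le_of_lt ha
  obtain ⟨b', hxb, hb'⟩ := exists_covBy_le_of_lt hb
  intro h
  obtain rfl : a' = b' := h hxa hxb
  exact hx a' ha' hb' hxa.lt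

/-! ### Retractible elements and pendant vertices -/

theorem exists_isChain_covBy_cons [Finite α] (h : y ≤ z) :
    ∃ l : List α, (y :: l).IsChain (· ⋖ ·) ∧ (y :: l).getLast? = some z := by
  classical
  have := Fintype.ofFinite α
  let _ : LocallyFiniteOrder α := Fintype.toLocallyFiniteOrder
  obtain ⟨l, hl, hz⟩ := List.exists_isChain_cons_of_relationReflTransGen
    (le_iff_reflTransGen_covBy.1 h)
  exact ⟨l, hl, by rw [List.getLast?_eq_some_getLast (by simp), hz]⟩

theorem exists_isChain_covBy_mem [Finite α] {w : α} (hyw : y ≤ w) (hwz : w ≤ z) :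
    ∃ l : List α, l.IsChain (· ⋖ ·) ∧ l.head? = some y ∧ l.getLast? = some z ∧ w ∈ l := by
  obtain ⟨l, hl, hlw⟩ := exists_isChain_covBy_cons hyw
  obtain ⟨l', hl', hlz⟩ := exists_isChain_covBy_cons hwz
  rw [List.isChain_cons] at hl'
  refine ⟨y :: l ++ l', List.isChain_append.2 ⟨hl, hl'.2, fun u hu => ?_⟩, rfl, ?_,
    List.mem_append_left _ (List.mem_of_getLast? hlw)⟩
  · obtain rfl : w = u := by simpa [hlw] using hu
    exact hl'.1
  · rw [List.getLast?_append, hlw]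
    simpa [List.getLast?_cons, Option.getD_eq_iff, Option.or_eq_some_iff] using hlz

theorem eq_of_isChain_covBy (hyx : y ⋖ x) (hxz : x ⋖ z) (hx : ∀ w, y < w → w < z → w = x)
    {l : List α} (hl : l.IsChain (· ⋖ ·)) (hy : l.head? = some y) (hz : l.getLast? = some z) :
    l = [y, x, z] := by
  have hyz : y < z := hyx.lt.trans hxz.lt
  obtain ⟨l, rfl⟩ := List.head?_eq_some_iff.1 hy
  rcases l.eq_nil_or_concat' with rfl | ⟨m, t, rfl⟩
  · exact absurd (by simpa using hz) hyz.ne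
  obtain rfl : t = z := by
    rwa [← List.cons_append, List.getLast?_concat, Option.some.injEq] at hz
  have hlt : (y :: (m ++ [t])).Pairwise (· < ·) := (hl.imp fun _ _ h => h.lt).pairwise
  obtain ⟨hym, hm, -, hmt⟩ : (∀ w ∈ m ++ [t], y < w) ∧ m.Pairwise (· < ·) ∧
      [t].Pairwise (· < ·) ∧ ∀ w ∈ m, ∀ w' ∈ [t], w < w' := by
    simpa only [List.pairwise_cons, List.pairwise_append] using hlt
  have hmx : m = List.replicate m.length x := List.eq_replicate_iff.2 ⟨rfl, fun w hw =>
    hx w (hym w (List.mem_append_left _ hw)) (hmt w hw t (List.mem_singleton_self t))⟩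
  have hlen : m.length ≤ 1 := by
    rw [← List.nodup_replicate (a := x), ← hmx]
    exact hm.imp fun h => h.ne
  interval_cases hm1 : m.length
  · obtain rfl : m = [] := hmx
    exact absurd hxz.lt (((List.isChain_cons_cons.1 hl).1).2 hyx.lt)
  · rw [hmx]
    rfl

theorem covBy_path_unique_iff [Finite α] (hyx : y ⋖ x) (hxz : x ⋖ z) :
    (∀ l : List α, l.IsChain (· ⋖ ·) → l.head? = some y → l.getLast? = some z → l = [y, x, z]) ↔
      ∀ w, y < w → w < z → w = x := by
  refine ⟨fun h w hyw hwz => ?_, fun h l => eq_of_isChain_covBy hyx hxz h⟩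
  obtain ⟨l, hl, hy, hz, hw⟩ := exists_isChain_covBy_mem hyw.le hwz.le
  rw [h l hl hy hz] at hw
  simpa [hyw.ne', hwz.ne] using hw

theorem IsIrrStar.isRetractible_iff [Finite α] (hx : IsIrrStar x) :
    IsRetractible x ↔
      ∀ y z, y ⋖ x → x ⋖ z → IsRed y → IsRed z → ∀ w, y < w → w < z → w = x := by
  constructor
  · rintro ⟨hi, h | ⟨y, z, -, -, hyx, hxz, h⟩⟩ y' z' hyx' hxz' hy' hz'
    · exact absurd ⟨y', z', hy', hz', hyx', hxz'⟩ h
    · obtain rfl := hi.1 hyx hyx'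
      obtain rfl := hi.2 hxz hxz'
      exact (covBy_path_unique_iff hyx hxz).1 h
  · intro h
    refine ⟨hx.isIrr, ?_⟩
    by_cases hc : ∃ y z : α, IsRed y ∧ IsRed z ∧ y ⋖ x ∧ x ⋖ z
    · obtain ⟨y, z, hy, hz, hyx, hxz⟩ := hc
      exact .inr ⟨y, z, hy, hz, hyx, hxz,
        (covBy_path_unique_iff hyx hxz).2 (h y z hyx hxz hy hz)⟩
    · exact .inl hc

theorem not_isPendant_of_ne (hyz : y ≠ z) (hy : (SimpleGraph.hasse α).Adj x y)
    (hz : (SimpleGraph.hasse α).Adj x z) : ¬ IsPendant x := by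
  intro h
  obtain ⟨w, hw⟩ := Set.ncard_eq_one.1 h
  rw [← SimpleGraph.mem_neighborSet, hw] at hy hz
  exact hyz (hy.trans hz.symm)

theorem IsIrrStar.not_isPendant (hx : IsIrrStar x) : ¬ IsPendant x := by
  obtain ⟨⟨y, hy, -⟩, z, hz, -⟩ := hx
  exact not_isPendant_of_ne (hy.lt.trans hz.lt).ne (.inr hy) (.inl hz)

theorem IsRed.not_isPendant (hx : IsRed x) : ¬ IsPendant x := by
  rw [IsRed, IsIrr, not_and_or, Set.not_subsingleton_iff, Set.not_subsingleton_iff] at hx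
  rcases hx with ⟨y, hy, z, hz, hne⟩ | ⟨y, hy, z, hz, hne⟩
  · exact not_isPendant_of_ne hne (.inr hy) (.inr hz)
  · exact not_isPendant_of_ne hne (.inl hy) (.inl hz)

/-! ### Invariance under isomorphism -/

theorem isIrr_orderIso_iff (e : α ≃o β) : IsIrr (e x) ↔ IsIrr x := by
  have hlower : {y | y ⋖ e x} = e '' {y | y ⋖ x} := by
    ext y
    obtain ⟨y, rfl⟩ := e.surjective y
    simp
  have hupper : {y | e x ⋖ y} = e '' {y | x ⋖ y} := by
    ext y
    obtain ⟨y, rfl⟩ := e.surjective y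
    simp
  rw [IsIrr, IsIrr, hlower, hupper, e.injective.subsingleton_image_iff,
    e.injective.subsingleton_image_iff]

theorem isRed_orderIso_iff (e : α ≃o β) : IsRed (e x) ↔ IsRed x :=
  not_congr (isIrr_orderIso_iff e)

theorem isIrrStar_orderIso_iff (e : α ≃o β) : IsIrrStar (e x) ↔ IsIrrStar x := by
  simp only [IsIrrStar, e.bijective.existsUnique_iff, apply_covBy_apply_iff]

theorem IsIrrStar.isRetractible_orderIso_iff [Finite α] (hx : IsIrrStar x) (e : α ≃o β) :
    IsRetractible (e x) ↔ IsRetractible x := by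
  have : Finite β := Finite.of_equiv _ e.toEquiv
  rw [hx.isRetractible_iff, ((isIrrStar_orderIso_iff e).2 hx).isRetractible_iff]
  simp only [e.surjective.forall, apply_covBy_apply_iff, isRed_orderIso_iff e, e.lt_iff_lt,
    e.injective.eq_iff]

theorem isBasicRetract_congr [Finite α] (e : α ≃o β) : IsBasicRetract β ↔ IsBasicRetract α := by
  rw [IsBasicRetract, e.surjective.forall]
  refine forall_congr' fun x => ?_
  rw [isIrrStar_orderIso_iff e]
  exact forall_congr' fun hx => not_congr (hx.isRetractible_orderIso_iff e)

theorem nullity_congr (e : α ≃o β) : nullity α = nullity β := by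
  let g : SimpleGraph.hasse α ≃g SimpleGraph.hasse β :=
    ⟨e.toEquiv, by simp [SimpleGraph.hasse_adj]⟩
  rw [nullity, nullity, Nat.card_congr e.toEquiv, Nat.card_congr g.connectedComponentEquiv,
    ← Nat.card_coe_set_eq, ← Nat.card_coe_set_eq, Nat.card_congr g.mapEdgeSet]

/-! ### Nullity in terms of covering pairs -/

theorem ncard_edgeSet_hasse :
    (SimpleGraph.hasse α).edgeSet.ncard = {p : α × α | p.1 ⋖ p.2}.ncard := by
  have himage : (SimpleGraph.hasse α).edgeSet =
      (fun p : α × α => s(p.1, p.2)) '' {p | p.1 ⋖ p.2} := by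
    ext ⟨a, b⟩
    simp only [Set.mem_image, Set.mem_ofPred_eq, Prod.exists]
    change (a ⋖ b ∨ b ⋖ a) ↔ ∃ x y, x ⋖ y ∧ s(x, y) = s(a, b)
    grind
  rw [himage, Set.InjOn.ncard_image]
  rintro ⟨a, b⟩ (hab : a ⋖ b) ⟨c, d⟩ (hcd : c ⋖ d) h
  rcases Sym2.eq_iff.1 h with ⟨rfl, rfl⟩ | ⟨rfl, rfl⟩
  · rfl
  · exact absurd hab.lt hcd.lt.asymm

theorem preconnected_hasse [Finite α] (hb : IsBot b) : (SimpleGraph.hasse α).Preconnected := by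
  classical
  have := Fintype.ofFinite α
  let _ : LocallyFiniteOrder α := Fintype.toLocallyFiniteOrder
  have key (x : α) : (SimpleGraph.hasse α).Reachable b x := by
    induction le_iff_reflTransGen_covBy.1 (hb x) with
    | refl => exact SimpleGraph.Reachable.refl b
    | tail _ h ih => exact ih.trans (SimpleGraph.Adj.reachable (.inl h))
  exact fun x y => (key x).symm.trans (key y)

theorem nullity_of_isBot [Finite α] (hb : IsBot b) :
    nullity α = {p : α × α | p.1 ⋖ p.2}.ncard - Nat.card α + 1 := by
  have hsub := (preconnected_hasse hb).subsingleton_connectedComponent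
  have : Nonempty (SimpleGraph.hasse α).ConnectedComponent :=
    ⟨(SimpleGraph.hasse α).connectedComponentMk b⟩
  rw [nullity, ncard_edgeSet_hasse,
    Nat.card_eq_one_iff_unique.2 ⟨hsub, inferInstance⟩, Nat.cast_one]

end FinitePoset

/-! ### Reducible elements of a finite lattice -/

section FiniteLattice

variable {α : Type*} [Lattice α] {a : α}

theorem isJoinReducible_iff_not_subsingleton [Finite α] :
    IsJoinReducible a ↔ ¬ {y | y ⋖ a}.Subsingleton := by
  constructor
  · rintro ⟨b, c, hb, hc, rfl⟩
    exact not_subsingleton_lowerCovers (le_sup_left.lt_of_ne hb) (le_sup_right.lt_of_ne hc)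
      fun z hbz hcz => (sup_le hbz hcz).not_gt
  · rw [Set.not_subsingleton_iff]
    rintro ⟨b, hb, c, hc, hbc⟩
    exact ⟨b, c, hb.ne, hc.ne, hb.wcovBy.sup_eq hc.wcovBy hbc⟩

theorem isMeetReducible_iff_not_subsingleton [Finite α] :
    IsMeetReducible a ↔ ¬ {y | a ⋖ y}.Subsingleton := by
  constructor
  · rintro ⟨b, c, hb, hc, rfl⟩
    exact not_subsingleton_upperCovers (inf_le_left.lt_of_ne' hb) (inf_le_right.lt_of_ne' hc)
      fun z hbz hcz => (le_inf hbz hcz).not_gt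
  · rw [Set.not_subsingleton_iff]
    rintro ⟨b, hb, c, hc, hbc⟩
    exact ⟨b, c, hb.ne', hc.ne', hb.wcovBy.inf_eq hc.wcovBy hbc⟩

theorem isReducible_iff_isRed [Finite α] : IsReducible a ↔ IsRed a := by
  rw [IsReducible, isMeetReducible_iff_not_subsingleton, isJoinReducible_iff_not_subsingleton,
    or_comm, ← not_and_or, IsRed, IsIrr]

theorem isJoinReducible_iff_isReducible_of_isTop (ha : IsTop a) :
    IsJoinReducible a ↔ IsReducible a := by
  refine ⟨.inr, fun h => h.resolve_left ?_⟩
  rintro ⟨b, c, hb, -, rfl⟩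
  exact hb ((ha b).antisymm inf_le_left)

theorem isMeetReducible_iff_isReducible_of_isBot (ha : IsBot a) :
    IsMeetReducible a ↔ IsReducible a := by
  refine ⟨.inl, fun h => h.resolve_right ?_⟩
  rintro ⟨b, c, hb, -, rfl⟩
  exact hb (le_sup_left.antisymm (ha b))

end FiniteLattice

/-! ### Webs: strands stretched over a chain of nodes -/

/-- A pair `src < tgt` of nodes, to be joined by strands. -/
@[ext]
structure Gap (ι : Type*) [LT ι] where
  src : ι
  tgt : ι
  lt : src < tgt
deriving DecidableEq

/-- The universal poset whose reducible elements form the chain `ι`: the nodes form a copy of `ι`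
and over each gap there are infinitely many infinite strands, `link q i p` being the element at
position `p` of the `i`-th strand over `q`. Every finite block whose reducible elements form a
chain is isomorphic to a finite subset of it. -/
inductive Web (ι : Type*) [LT ι] where
  | node (v : ι) : Web ι
  | link (q : Gap ι) (i p : ℕ) : Web ι
deriving DecidableEq

instance instFintypeGap {ι : Type*} [LT ι] [Fintype ι] [DecidableLT ι] : Fintype (Gap ι) :=
  Fintype.ofEquiv {q : ι × ι // q.1 < q.2}
    { toFun q := ⟨q.1.1, q.1.2, q.2⟩
      invFun q := ⟨(q.src, q.tgt), q.lt⟩ }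

instance instDecidableRelCovBy {ι : Type*} [Preorder ι] [Fintype ι] [DecidableLT ι] :
    DecidableRel (α := ι) (· ⋖ ·) :=
  fun a b => decidable_of_iff (a < b ∧ ∀ c, a < c → ¬ c < b) Iff.rfl

theorem Gap.eq_of_covBy {ι : Type*} [LinearOrder ι] {q r : Gap ι} (hq : q.src ⋖ q.tgt)
    (hsrc : q.src ≤ r.src) (htgt : r.tgt ≤ q.tgt) : r = q :=
  Gap.ext (hsrc.eq_of_not_lt' fun hlt => hq.2 hlt (r.lt.trans_le htgt))
    (htgt.eq_of_not_lt fun hlt => hq.2 (hsrc.trans_lt r.lt) hlt)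

namespace Web

variable {ι : Type*} [LinearOrder ι]

/-- Elements of different strands are comparable only through the nodes between them. -/
def le : Web ι → Web ι → Prop
  | node v, node w => v ≤ w
  | node v, link q _ _ => v ≤ q.src
  | link q _ _, node v => q.tgt ≤ v
  | link q i p, link q' i' p' => (q = q' ∧ i = i' ∧ p ≤ p') ∨ q.tgt ≤ q'.src

instance : PartialOrder (Web ι) where
  le := le
  le_refl x := by cases x <;> simp [le]
  le_trans x y z := by
    have h := Gap.lt (ι := ι)
    rcases x with u | ⟨q, i, p⟩ <;> rcases y with v | ⟨q', i', p'⟩ <;>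
      rcases z with w | ⟨q'', i'', p''⟩ <;> simp only [le] <;> grind
  le_antisymm x y := by
    have h := Gap.lt (ι := ι)
    rcases x with u | ⟨q, i, p⟩ <;> rcases y with v | ⟨q', i', p'⟩ <;> simp only [le] <;> grind

variable {q q' : Gap ι} {i i' p p' : ℕ} {v w : ι}

@[simp] theorem node_le_node : node v ≤ node w ↔ v ≤ w := Iff.rfl
@[simp] theorem node_le_link : node v ≤ link q i p ↔ v ≤ q.src := Iff.rfl
@[simp] theorem link_le_node : link q i p ≤ node v ↔ q.tgt ≤ v := Iff.rfl
theorem link_le_link :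
    link q i p ≤ link q' i' p' ↔ (q = q' ∧ i = i' ∧ p ≤ p') ∨ q.tgt ≤ q'.src := Iff.rfl

@[simp] theorem node_lt_node : node v < node w ↔ v < w := by
  simp only [lt_iff_le_not_ge, node_le_node]

@[simp] theorem node_lt_link : node v < link q i p ↔ v ≤ q.src := by
  simp only [lt_iff_le_not_ge, node_le_link, link_le_node, and_iff_left_iff_imp]
  exact fun h => not_le.2 (h.trans_lt q.lt)

@[simp] theorem link_lt_node : link q i p < node v ↔ q.tgt ≤ v := by
  simp only [lt_iff_le_not_ge, node_le_link, link_le_node, and_iff_left_iff_imp]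
  exact fun h => not_le.2 (q.lt.trans_le h)

theorem link_lt_link :
    link q i p < link q' i' p' ↔ (q = q' ∧ i = i' ∧ p < p') ∨ q.tgt ≤ q'.src := by
  have h := Gap.lt (ι := ι)
  simp only [lt_iff_le_not_ge, link_le_link]
  grind

@[simp] theorem link_le_link_same : link q i p ≤ link q i' p' ↔ i = i' ∧ p ≤ p' := by
  simp only [link_le_link, true_and, or_iff_left_iff_imp]
  exact fun h => absurd h q.lt.not_ge

@[simp] theorem link_lt_link_same : link q i p < link q i' p' ↔ i = i' ∧ p < p' := by
  simp only [link_lt_link, true_and, or_iff_left_iff_imp]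
  exact fun h => absurd h q.lt.not_ge

instance : DecidableLE (Web ι)
  | node v, node w => inferInstanceAs (Decidable (v ≤ w))
  | node v, link q _ _ => inferInstanceAs (Decidable (v ≤ q.src))
  | link q _ _, node v => inferInstanceAs (Decidable (q.tgt ≤ v))
  | link q i p, link q' i' p' =>
    inferInstanceAs (Decidable ((q = q' ∧ i = i' ∧ p ≤ p') ∨ q.tgt ≤ q'.src))

/-- The indices of the strands over the gap `q` that meet `X`. -/
def strands (X : Finset (Web ι)) (q : Gap ι) : Finset ℕ :=
  X.biUnion fun
    | node _ => ∅
    | link q' i _ => if q' = q then {i} else ∅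

/-- The positions of the elements of `X` on the `i`-th strand over the gap `q`. -/
def strand (X : Finset (Web ι)) (q : Gap ι) (i : ℕ) : Finset ℕ :=
  X.biUnion fun
    | node _ => ∅
    | link q' i' p => if q' = q ∧ i' = i then {p} else ∅

/-- The sizes of the nonempty strands of `X` over the gap `q`. -/
def sizes (X : Finset (Web ι)) (q : Gap ι) : Multiset ℕ :=
  (strands X q).val.map fun i => (strand X q i).card

/-- The number of nonempty strands of `X` over the gap `q`. -/
def width (X : Finset (Web ι)) (q : Gap ι) : ℕ := (strands X q).card

variable {X : Finset (Web ι)}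

theorem mem_strands : i ∈ strands X q ↔ ∃ p, link q i p ∈ X := by
  simp only [strands, Finset.mem_biUnion]
  constructor
  · rintro ⟨_ | ⟨q', i', p⟩, hx, hi⟩
    · simp at hi
    · obtain ⟨rfl, rfl⟩ : q' = q ∧ i = i' := by grind
      exact ⟨p, hx⟩
  · rintro ⟨p, hp⟩
    exact ⟨_, hp, by simp⟩

theorem mem_strand : p ∈ strand X q i ↔ link q i p ∈ X := by
  simp only [strand, Finset.mem_biUnion]
  constructor
  · rintro ⟨_ | ⟨q', i', p'⟩, hx, hp⟩
    · simp at hp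
    · obtain ⟨⟨rfl, rfl⟩, rfl⟩ : (q' = q ∧ i' = i) ∧ p = p' := by grind
      exact hx
  · exact fun hp => ⟨_, hp, by simp⟩

theorem mem_strands_of_mem (h : link q i p ∈ X) : i ∈ strands X q := mem_strands.2 ⟨p, h⟩

theorem strand_nonempty : (strand X q i).Nonempty ↔ i ∈ strands X q := by
  simp only [Finset.Nonempty, mem_strand, mem_strands]

theorem card_sizes : Multiset.card (sizes X q) = width X q := Multiset.card_map _ _

theorem width_eq_card_sizes (X : Finset (Web ι)) :
    width X = fun q => Multiset.card (sizes X q) :=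
  funext fun _ => card_sizes.symm

theorem width_ne_zero_iff : width X q ≠ 0 ↔ ∃ i p, link q i p ∈ X := by
  simp only [width, Finset.card_ne_zero, Finset.Nonempty, mem_strands]

theorem zero_notMem_sizes : 0 ∉ sizes X q := by
  simp only [sizes, Multiset.mem_map, Finset.mem_val, not_exists, not_and]
  exact fun i hi => Finset.card_ne_zero.2 (strand_nonempty.2 hi)

theorem card_eq_card_add_sum_sizes [Fintype ι] (hX : ∀ v, node v ∈ X) :
    X.card = Fintype.card ι + ∑ q, (sizes X q).sum := by
  have hlinks : ∑ q, (sizes X q).sum =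
      (Finset.univ.sigma fun q => (strands X q).sigma (strand X q)).card := by
    simp only [Finset.card_sigma]
    rfl
  rw [hlinks, ← Finset.card_univ, ← Finset.card_disjSum]
  symm
  refine Finset.card_nbij (Sum.elim node fun l => link l.1 l.2.1 l.2.2) ?_ ?_ ?_
  · rintro (v | ⟨q, i, p⟩) h
    · exact hX v
    · simp only [Finset.mem_coe, Finset.inr_mem_disjSum, Finset.mem_sigma, mem_strand] at h
      exact h.2.2
  · rintro (v | ⟨q, i, p⟩) - (v' | ⟨q', i', p'⟩) - h
    all_goals simp_all
  · rintro (v | ⟨q, i, p⟩) h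
    · exact ⟨.inl v, by simp, rfl⟩
    · exact ⟨.inr ⟨q, i, p⟩, by simpa [mem_strand, mem_strands] using ⟨⟨p, h⟩, h⟩, rfl⟩

end Web

namespace Web

/-! ### Covers and reducible elements of a finite part of the web -/

variable {ι : Type*} [LinearOrder ι] {X : Finset (Web ι)} {q : Gap ι} {i p : ℕ} {v : ι}

theorem exists_isGreatest_Iio_link (hX : ∀ v, node v ∈ X) (h : link q i p ∈ X) :
    ∃ y, IsGreatest (Set.Iio (⟨link q i p, h⟩ : X)) y := by
  by_cases hne : ((strand X q i).filter (· < p)).Nonempty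
  · obtain ⟨hmem, hlt⟩ := Finset.mem_filter.1 (Finset.max'_mem _ hne)
    refine ⟨⟨_, mem_strand.1 hmem⟩, link_lt_link_same.2 ⟨rfl, hlt⟩, ?_⟩
    rintro ⟨u | ⟨q', i', p'⟩, hz⟩ hlt <;> rw [Set.mem_Iio, Subtype.mk_lt_mk] at hlt
    · exact node_le_link.2 (node_lt_link.1 hlt)
    · rcases link_lt_link.1 hlt with ⟨rfl, rfl, hp⟩ | hle
      · exact link_le_link_same.2 ⟨rfl, Finset.le_max' _ _ (by simp [mem_strand, hz, hp])⟩
      · exact link_le_link.2 (.inr hle)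
  · refine ⟨⟨node q.src, hX _⟩, node_lt_link.2 le_rfl, ?_⟩
    rintro ⟨u | ⟨q', i', p'⟩, hz⟩ hlt <;> rw [Set.mem_Iio, Subtype.mk_lt_mk] at hlt
    · exact node_le_node.2 (node_lt_link.1 hlt)
    · rcases link_lt_link.1 hlt with ⟨rfl, rfl, hp⟩ | hle
      · exact absurd ⟨p', by simp [mem_strand, hz, hp]⟩ hne
      · exact link_le_node.2 hle

theorem exists_isLeast_Ioi_link (hX : ∀ v, node v ∈ X) (h : link q i p ∈ X) :
    ∃ y, IsLeast (Set.Ioi (⟨link q i p, h⟩ : X)) y := by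
  by_cases hne : ((strand X q i).filter (p < ·)).Nonempty
  · obtain ⟨hmem, hlt⟩ := Finset.mem_filter.1 (Finset.min'_mem _ hne)
    refine ⟨⟨_, mem_strand.1 hmem⟩, link_lt_link_same.2 ⟨rfl, hlt⟩, ?_⟩
    rintro ⟨u | ⟨q', i', p'⟩, hz⟩ hlt <;> rw [Set.mem_Ioi, Subtype.mk_lt_mk] at hlt
    · exact link_le_node.2 (link_lt_node.1 hlt)
    · rcases link_lt_link.1 hlt with ⟨rfl, rfl, hp⟩ | hle
      · exact link_le_link_same.2 ⟨rfl, Finset.min'_le _ _ (by simp [mem_strand, hz, hp])⟩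
      · exact link_le_link.2 (.inr hle)
  · refine ⟨⟨node q.tgt, hX _⟩, link_lt_node.2 le_rfl, ?_⟩
    rintro ⟨u | ⟨q', i', p'⟩, hz⟩ hlt <;> rw [Set.mem_Ioi, Subtype.mk_lt_mk] at hlt
    · exact node_le_node.2 (link_lt_node.1 hlt)
    · rcases link_lt_link.1 hlt with ⟨rfl, rfl, hp⟩ | hle
      · exact absurd ⟨p', by simp [mem_strand, hz, hp]⟩ hne
      · exact node_le_link.2 hle

theorem isIrrStar_link (hX : ∀ v, node v ∈ X) (h : link q i p ∈ X) :
    IsIrrStar (⟨link q i p, h⟩ : X) := by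
  obtain ⟨y, hy⟩ := exists_isGreatest_Iio_link hX h
  obtain ⟨z, hz⟩ := exists_isLeast_Ioi_link hX h
  exact isIrrStar_of_isGreatest_of_isLeast hy hz

variable [Fintype ι]

/-- The number of strands over each gap, without the one strand over a consecutive gap that only
subdivides the cover `q.src ⋖ q.tgt` and makes neither of the two nodes reducible. -/
def excess (n : Gap ι → ℕ) (q : Gap ι) : ℕ := if q.src ⋖ q.tgt then n q - 1 else n q

/-- Every node is an end of a gap on which `e` does not vanish. -/
def IsSpanning (e : Gap ι → ℕ) : Prop := ∀ v, ∃ q : Gap ι, (q.src = v ∨ q.tgt = v) ∧ e q ≠ 0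

/-- All nodes belong to `X` and are reducible in `X`. -/
structure Reduced (X : Finset (Web ι)) : Prop where
  node_mem : ∀ v, node v ∈ X
  isSpanning : IsSpanning (excess (width X))

theorem excess_width_eq_zero_iff (hi : i ∈ strands X q) :
    excess (width X) q = 0 ↔ q.src ⋖ q.tgt ∧ strands X q = {i} := by
  have hpos : 0 < width X q := Finset.card_pos.2 ⟨i, hi⟩
  have hone : strands X q = {i} ↔ width X q = 1 := by
    rw [width, Finset.card_eq_one]
    exact ⟨fun h => ⟨i, h⟩, fun ⟨k, hk⟩ => by grind⟩
  rw [excess, hone]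
  split_ifs with hq <;> grind

theorem exists_mem_of_excess_ne_zero (hX : ∀ v, node v ∈ X) (hq : excess (width X) q ≠ 0) :
    ∃ a ∈ X, ∃ b ∈ X, (node q.src < a ∧ node q.src < b ∧ a < node q.tgt ∧ b < node q.tgt) ∧
      (∀ z, a ≤ z → b ≤ z → ¬ z < node q.tgt) ∧ ∀ z, z ≤ a → z ≤ b → ¬ node q.src < z := by
  have hlt := Gap.lt (ι := ι)
  obtain ⟨i, p, hp⟩ := width_ne_zero_iff.1 fun (h : width X q = 0) => hq (by simp [excess, h])
  have hi := mem_strands_of_mem hp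
  rw [Ne, excess_width_eq_zero_iff hi] at hq
  by_cases hcov : q.src ⋖ q.tgt
  · obtain ⟨i', hi', hne⟩ : ∃ i' ∈ strands X q, i' ≠ i := by
      by_contra! h
      exact hq ⟨hcov, Finset.eq_singleton_iff_unique_mem.2 ⟨hi, h⟩⟩
    obtain ⟨p', hp'⟩ := mem_strands.1 hi'
    refine ⟨_, hp, _, hp', by simp, ?_, ?_⟩ <;> rintro (v | ⟨r, k, s⟩) <;>
      simp only [node_le_link, link_le_node, node_lt_node, node_lt_link, link_lt_node,
        link_le_link] <;> grind
  · obtain ⟨w, hw, hw'⟩ := exists_lt_lt_of_not_covBy q.lt hcov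
    refine ⟨_, hp, _, hX w, by simp [hw, hw'], ?_, ?_⟩ <;> rintro (v | ⟨r, k, s⟩) <;>
      simp only [node_le_link, link_le_node, node_lt_node, node_lt_link, link_lt_node,
        link_le_link, node_le_node] <;> grind

theorem subsingleton_lowerCovers_node_iff (hX : ∀ v, node v ∈ X) :
    {y : X | y ⋖ ⟨node v, hX v⟩}.Subsingleton ↔
      ∀ q : Gap ι, q.tgt = v → excess (width X) q = 0 := by
  constructor
  · rintro h q rfl
    by_contra hq
    obtain ⟨a, ha, b, hb, ⟨-, -, hav, hbv⟩, hab, -⟩ := exists_mem_of_excess_ne_zero hX hq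
    exact not_subsingleton_lowerCovers (α := X) (a := ⟨a, ha⟩) (b := ⟨b, hb⟩) hav hbv
      (fun z haz hbz => hab z haz hbz) h
  · intro h y hy y' hy'
    suffices y ≤ y' ∨ y' ≤ y by
      rcases this with hle | hle
      · exact hle.eq_of_not_lt fun hlt => hy.2 hlt hy'.lt
      · exact (hle.eq_of_not_lt fun hlt => hy'.2 hlt hy.lt).symm
    have hlink {q i p} (hp : link q i p ∈ X) (hc : (⟨link q i p, hp⟩ : X) ⋖ ⟨node v, hX v⟩) :
        q.tgt = v ∧ q.src ⋖ v ∧ strands X q = {i} := by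
      obtain rfl : q.tgt = v := (link_lt_node.1 hc.lt).eq_of_not_lt fun hlt =>
        hc.2 (c := ⟨node q.tgt, hX _⟩) (link_lt_node.2 le_rfl) (node_lt_node.2 hlt)
      exact ⟨rfl, (excess_width_eq_zero_iff (mem_strands_of_mem hp)).1 (h q rfl)⟩
    obtain ⟨u | ⟨q, i, p⟩, hp⟩ := y <;> obtain ⟨u' | ⟨q', i', p'⟩, hp'⟩ := y'
    · exact le_total u u'
    · obtain ⟨-, hq', -⟩ := hlink hp' hy'
      exact .inl (hq'.le_of_lt (node_lt_node.1 hy.lt))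
    · obtain ⟨-, hq, -⟩ := hlink hp hy
      exact .inr (hq.le_of_lt (node_lt_node.1 hy'.lt))
    · obtain ⟨hv, hq, hi⟩ := hlink hp hy
      obtain ⟨hv', hq', -⟩ := hlink hp' hy'
      obtain rfl : q = q' := Gap.ext (hq.unique_left hq') (hv.trans hv'.symm)
      obtain rfl : i' = i := by simpa [hi] using mem_strands_of_mem hp'
      exact (le_total p p').imp (fun h => link_le_link_same.2 ⟨rfl, h⟩)
        fun h => link_le_link_same.2 ⟨rfl, h⟩

theorem subsingleton_upperCovers_node_iff (hX : ∀ v, node v ∈ X) :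
    {y : X | ⟨node v, hX v⟩ ⋖ y}.Subsingleton ↔
      ∀ q : Gap ι, q.src = v → excess (width X) q = 0 := by
  constructor
  · rintro h q rfl
    by_contra hq
    obtain ⟨a, ha, b, hb, ⟨hva, hvb, -, -⟩, -, hab⟩ := exists_mem_of_excess_ne_zero hX hq
    exact not_subsingleton_upperCovers (α := X) (a := ⟨a, ha⟩) (b := ⟨b, hb⟩) hva hvb
      (fun z haz hbz => hab z haz hbz) h
  · intro h y hy y' hy'
    suffices y ≤ y' ∨ y' ≤ y by
      rcases this with hle | hle
      · exact hle.eq_of_not_lt fun hlt => hy'.2 hy.lt hlt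
      · exact (hle.eq_of_not_lt fun hlt => hy.2 hy'.lt hlt).symm
    have hlink {q i p} (hp : link q i p ∈ X) (hc : (⟨node v, hX v⟩ : X) ⋖ ⟨link q i p, hp⟩) :
        q.src = v ∧ v ⋖ q.tgt ∧ strands X q = {i} := by
      obtain rfl : v = q.src := (node_lt_link.1 hc.lt).eq_of_not_lt fun hlt =>
        hc.2 (c := ⟨node q.src, hX _⟩) (node_lt_node.2 hlt) (node_lt_link.2 le_rfl)
      exact ⟨rfl, (excess_width_eq_zero_iff (mem_strands_of_mem hp)).1 (h q rfl)⟩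
    obtain ⟨u | ⟨q, i, p⟩, hp⟩ := y <;> obtain ⟨u' | ⟨q', i', p'⟩, hp'⟩ := y'
    · exact le_total u u'
    · obtain ⟨-, hq', -⟩ := hlink hp' hy'
      exact .inr (hq'.ge_of_gt (node_lt_node.1 hy.lt))
    · obtain ⟨-, hq, -⟩ := hlink hp hy
      exact .inl (hq.ge_of_gt (node_lt_node.1 hy'.lt))
    · obtain ⟨hv, hq, hi⟩ := hlink hp hy
      obtain ⟨hv', hq', -⟩ := hlink hp' hy'
      obtain rfl : q = q' := Gap.ext (hv.trans hv'.symm) (hq.unique_right hq')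
      obtain rfl : i' = i := by simpa [hi] using mem_strands_of_mem hp'
      exact (le_total p p').imp (fun h => link_le_link_same.2 ⟨rfl, h⟩)
        fun h => link_le_link_same.2 ⟨rfl, h⟩

theorem Reduced.isRed_node (hX : Reduced X) (v : ι) : IsRed (⟨node v, hX.node_mem v⟩ : X) := by
  rw [IsRed, IsIrr, subsingleton_lowerCovers_node_iff hX.node_mem,
    subsingleton_upperCovers_node_iff hX.node_mem]
  rintro ⟨hlower, hupper⟩
  obtain ⟨q, hv, hq⟩ := hX.isSpanning v
  exact hv.elim (fun h => hq (hupper q h)) fun h => hq (hlower q h)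

theorem Reduced.isRed_iff (hX : Reduced X) {x : X} : IsRed x ↔ ∃ v, x.1 = node v := by
  obtain ⟨v | ⟨q, i, p⟩, hx⟩ := x
  · exact iff_of_true (hX.isRed_node v) ⟨v, rfl⟩
  · exact iff_of_false (not_not_intro (isIrrStar_link hX.node_mem hx).isIrr) (by simp)

theorem Reduced.isRed_or_isIrrStar (hX : Reduced X) (x : X) : IsRed x ∨ IsIrrStar x := by
  obtain ⟨v | ⟨q, i, p⟩, hx⟩ := x
  · exact .inl (hX.isRed_node v)
  · exact .inr (isIrrStar_link hX.node_mem hx)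

end Web

/-! ### Strand sizes and isomorphisms -/

theorem count_map_val {α γ : Type*} [DecidableEq γ] (s : Finset α) (f : α → γ) (c : γ) :
    (s.val.map f).count c = Nat.card {a : s // f a = c} := by
  rw [Nat.card_eq_fintype_card, Fintype.card_subtype, Multiset.count_map, ← Finset.filter_val,
    Finset.card_val, ← Finset.card_map (Function.Embedding.subtype _)]
  congr 1
  ext a
  simp [eq_comm, and_comm]

theorem exists_equiv_of_map_val_eq {α β γ : Type*} {s : Finset α} {t : Finset β} {f : α → γ}
    {g : β → γ} (h : s.val.map f = t.val.map g) : ∃ σ : s ≃ t, ∀ a, g (σ a) = f a := by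
  classical
  have hfiber (c : γ) : Nonempty ({a : s // f a = c} ≃ {b : t // g b = c}) := by
    rw [← Finite.card_eq, ← count_map_val, ← count_map_val, h]
  let e (c : γ) := (hfiber c).some
  exact ⟨Equiv.ofFiberEquiv (f := fun a : s => f a) (g := fun b : t => g b) e,
    Equiv.ofFiberEquiv_map (f := fun a : s => f a) (g := fun b : t => g b) e⟩

namespace Web

variable {ι : Type*} [LinearOrder ι] {X Y : Finset (Web ι)} {q : Gap ι} {i p : ℕ}

theorem nonempty_orderEmbedding_of_sizes_eq (hY : ∀ v, node v ∈ Y) (h : sizes X = sizes Y) :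
    Nonempty (X ↪o Y) := by
  choose σ hσ using fun q => exists_equiv_of_map_val_eq (congrFun h q)
  let τ q (i : strands X q) : strand X q i ≃o strand Y q (σ q i) :=
    ((strand X q i).orderIsoOfFin rfl).symm.trans ((strand Y q (σ q i)).orderIsoOfFin (hσ q i))
  let φ : X → Y
    | ⟨node v, _⟩ => ⟨node v, hY v⟩
    | ⟨link q i p, hp⟩ =>
      ⟨link q (σ q ⟨i, mem_strands_of_mem hp⟩) (τ q ⟨i, _⟩ ⟨p, mem_strand.2 hp⟩),
        mem_strand.1 (Subtype.prop _)⟩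
  refine ⟨OrderEmbedding.ofMapLEIff φ ?_⟩
  rintro ⟨v | ⟨q, i, p⟩, hx⟩ ⟨v' | ⟨q', i', p'⟩, hy⟩
  · rfl
  · rfl
  · rfl
  · by_cases hq : q = q'
    · subst hq
      by_cases hi : i = i'
      · subst hi
        simp [φ]
      · simp [φ, hi]
    · simp [φ, link_le_link, hq]

theorem nonempty_orderIso_of_sizes_eq (hX : ∀ v, node v ∈ X) (hY : ∀ v, node v ∈ Y)
    (h : sizes X = sizes Y) : Nonempty (X ≃o Y) := by
  obtain ⟨f⟩ := nonempty_orderEmbedding_of_sizes_eq hY h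
  obtain ⟨g⟩ := nonempty_orderEmbedding_of_sizes_eq hX h.symm
  exact ⟨RelIso.ofSurjective f (f.injective.bijective_of_nat_card_le
    (Nat.card_le_card_of_injective g g.injective)).surjective⟩

theorem card_strand (X : Finset (Web ι)) (q : Gap ι) (i : ℕ) :
    (strand X q i).card = {x : X | ∃ p, x.1 = link q i p}.ncard := by
  have himage : Subtype.val '' {x : X | ∃ p, x.1 = link q i p} =
      link q i '' (strand X q i : Set ℕ) := by
    ext x
    simp only [Set.mem_image, Set.mem_ofPred_eq, Finset.mem_coe, mem_strand]
    exact ⟨fun ⟨y, ⟨p, hp⟩, hy⟩ => ⟨p, hp ▸ y.2, hp ▸ hy⟩,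
      fun ⟨p, hp, hx⟩ => ⟨⟨_, hp⟩, ⟨p, rfl⟩, hx⟩⟩
  rw [← Set.ncard_image_of_injective _ Subtype.val_injective, himage,
    Set.ncard_image_of_injective _ fun _ _ h => by simpa using h, Set.ncard_coe_finset]

variable [Fintype ι]

namespace Reduced

theorem orderIso_node (hX : Reduced X) (hY : Reduced Y) (e : X ≃o Y) (v : ι) :
    (e ⟨node v, hX.node_mem v⟩ : Web ι) = node v := by
  choose s hs using fun v => hY.isRed_iff.1 ((isRed_orderIso_iff e).2 (hX.isRed_node v))
  have hmono : StrictMono s := fun v w hvw => by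
    rw [← node_lt_node, ← hs, ← hs, Subtype.coe_lt_coe, e.lt_iff_lt]
    exact node_lt_node.2 hvw
  rw [hs, hmono.apply_le.antisymm hmono.le_apply]

theorem orderIso_link (hX : Reduced X) (hY : Reduced Y) (e : X ≃o Y) (h : link q i p ∈ X) :
    ∃ i' p', (e ⟨link q i p, h⟩ : Web ι) = link q i' p' := by
  obtain ⟨v, hv⟩ | ⟨q', i', p', he⟩ : (∃ v, (e ⟨link q i p, h⟩ : Web ι) = node v) ∨
      ∃ q' i' p', (e ⟨link q i p, h⟩ : Web ι) = link q' i' p' := by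
    rcases (e ⟨link q i p, h⟩ : Web ι) with v | ⟨q', i', p'⟩ <;> simp
  · exact absurd ((isRed_orderIso_iff e).1 (hY.isRed_iff.2 ⟨v, hv⟩))
      (not_not_intro (isIrrStar_link hX.node_mem h).isIrr)
  · have hsrc v : v ≤ q.src ↔ v ≤ q'.src := by
      rw [← node_le_link (q := q') (i := i') (p := p'), ← he,
        ← orderIso_node hX hY e, Subtype.coe_le_coe, e.le_iff_le]
      rfl
    have htgt v : q.tgt ≤ v ↔ q'.tgt ≤ v := by
      rw [← link_le_node (q := q') (i := i') (p := p'), ← he,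
        ← orderIso_node hX hY e, Subtype.coe_le_coe, e.le_iff_le]
      rfl
    obtain rfl : q = q' := Gap.ext (eq_of_forall_le_iff hsrc) (eq_of_forall_ge_iff htgt)
    exact ⟨i', p', he⟩

theorem exists_forall_orderIso_link (hX : Reduced X) (hY : Reduced Y) (e : X ≃o Y)
    (hi : i ∈ strands X q) :
    ∃ j, ∀ x : X, (∃ p, x.1 = link q i p) → ∃ r, (e x).1 = link q j r := by
  obtain ⟨p₀, h₀⟩ := mem_strands.1 hi
  obtain ⟨j, r₀, hr₀⟩ := hX.orderIso_link hY e h₀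
  refine ⟨j, fun ⟨x, hx⟩ => ?_⟩
  rintro ⟨p, rfl⟩
  obtain ⟨j', r, hr⟩ := hX.orderIso_link hY e hx
  have hcomp := (le_total p₀ p).imp
    (fun h => e.monotone (a := ⟨_, h₀⟩) (b := ⟨_, hx⟩) (link_le_link_same.2 ⟨rfl, h⟩))
    fun h => e.monotone (a := ⟨_, hx⟩) (b := ⟨_, h₀⟩) (link_le_link_same.2 ⟨rfl, h⟩)
  rw [← Subtype.coe_le_coe, ← Subtype.coe_le_coe, hr₀, hr, link_le_link_same,
    link_le_link_same] at hcomp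
  obtain rfl : j' = j := hcomp.elim (fun h => h.1.symm) fun h => h.1
  exact ⟨r, hr⟩

theorem exists_forall_orderIso_link_iff (hX : Reduced X) (hY : Reduced Y) (e : X ≃o Y)
    (hi : i ∈ strands X q) :
    ∃ j, ∀ x : X, (∃ p, x.1 = link q i p) ↔ ∃ r, (e x).1 = link q j r := by
  obtain ⟨j, hj⟩ := hX.exists_forall_orderIso_link hY e hi
  refine ⟨j, fun x => ⟨hj x, fun hx => ?_⟩⟩
  obtain ⟨p₀, h₀⟩ := mem_strands.1 hi
  obtain ⟨r₀, hr₀⟩ := hj ⟨_, h₀⟩ ⟨p₀, rfl⟩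
  have hj' : j ∈ strands Y q := mem_strands_of_mem (hr₀ ▸ Subtype.prop _)
  obtain ⟨i', hi'⟩ := hY.exists_forall_orderIso_link hX e.symm hj'
  obtain rfl : i = i' := by simpa using hi' _ ⟨r₀, hr₀⟩
  simpa using hi' _ hx

theorem sizes_eq_of_orderIso (hX : Reduced X) (hY : Reduced Y) (e : X ≃o Y) :
    sizes X = sizes Y := by
  funext q
  choose! j hj using fun i => hX.exists_forall_orderIso_link_iff hY e (q := q) (i := i)
  refine Multiset.map_eq_map_of_bij_of_nodup _ _ (strands X q).nodup (strands Y q).nodup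
    (fun i _ => j i) ?_ ?_ ?_ ?_
  · intro i hi
    obtain ⟨p, hp⟩ := mem_strands.1 hi
    obtain ⟨r, hr⟩ := (hj i hi ⟨_, hp⟩).1 ⟨p, rfl⟩
    exact mem_strands_of_mem (hr ▸ Subtype.prop _)
  · intro i hi i' hi' hii'
    obtain ⟨p, hp⟩ := mem_strands.1 hi
    obtain ⟨r, hr⟩ := (hj i hi ⟨_, hp⟩).1 ⟨p, rfl⟩
    obtain ⟨p', hp'⟩ := (hj i' hi' ⟨_, hp⟩).2 ⟨r, hii' ▸ hr⟩
    simp_all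
  · intro k hk
    obtain ⟨r, hr⟩ := mem_strands.1 hk
    obtain ⟨i, p, hp⟩ := hY.orderIso_link hX e.symm hr
    have hi : i ∈ strands X q := mem_strands_of_mem (hp ▸ Subtype.prop _)
    obtain ⟨r', hr'⟩ := (hj i hi (e.symm ⟨_, hr⟩)).1 ⟨p, hp⟩
    exact ⟨i, hi, by simp_all⟩
  · intro i hi
    rw [card_strand, card_strand, ← Set.ncard_image_of_injective _ e.injective]
    congr 1
    ext y
    obtain ⟨x, rfl⟩ := e.surjective y
    simp [← hj i hi]

end Reduced

end Web

/-! ### Retraction -/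

theorem exists_isBasicRetract_of_retractSteps {α : Type*} [PartialOrder α] [Finite α] (S : Set α) :
    ∃ R, Relation.ReflTransGen RetractStep S R ∧ IsBasicRetract R := by
  induction S using WellFoundedLT.induction with
  | _ S ih =>
    by_cases hS : IsBasicRetract S
    · exact ⟨S, .refl, hS⟩
    · simp only [IsBasicRetract, not_forall, not_not] at hS
      obtain ⟨x, hx, hr⟩ := hS
      obtain ⟨R, hR, hb⟩ := ih (S \ {(x : α)}) (Set.sdiff_singleton_ssubset.2 x.2)
      exact ⟨R, .head ⟨x, hx, hr, rfl⟩ hR, hb⟩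

namespace Web

variable {ι : Type*} [LinearOrder ι] {X : Finset (Web ι)} {q q' : Gap ι} {i p : ℕ}

theorem node_covBy_link (hX : ∀ v, node v ∈ X) (h : link q i p ∈ X) (hs : strand X q i = {p}) :
    (⟨node q.src, hX _⟩ : X) ⋖ ⟨link q i p, h⟩ := by
  refine ⟨node_lt_link.2 le_rfl, ?_⟩
  rintro ⟨v | ⟨r, k, s⟩, hc⟩ hlt hlt' <;> rw [Subtype.mk_lt_mk] at hlt hlt'
  · exact (node_lt_node.1 hlt).not_ge (node_lt_link.1 hlt')
  · rcases link_lt_link.1 hlt' with ⟨rfl, rfl, hsp⟩ | hle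
    · exact hsp.ne (by simpa [hs] using mem_strand.2 hc)
    · exact r.lt.not_ge (hle.trans (node_lt_link.1 hlt))

theorem link_covBy_node_iff (hX : ∀ v, node v ∈ X) (h : link q i p ∈ X) {v : ι} :
    (⟨link q i p, h⟩ : X) ⋖ ⟨node v, hX v⟩ ↔ q.tgt = v ∧ ∀ r ∈ strand X q i, r ≤ p := by
  constructor
  · intro hc
    refine ⟨(link_lt_node.1 hc.lt).eq_of_not_lt fun hlt =>
      hc.2 (c := ⟨node q.tgt, hX _⟩) (link_lt_node.2 le_rfl) (node_lt_node.2 hlt), fun r hr => ?_⟩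
    exact not_lt.1 fun hlt => hc.2 (c := ⟨_, mem_strand.1 hr⟩) (link_lt_link_same.2 ⟨rfl, hlt⟩)
      (link_lt_node.2 (link_lt_node.1 hc.lt))
  · rintro ⟨rfl, hp⟩
    refine ⟨link_lt_node.2 le_rfl, ?_⟩
    rintro ⟨v | ⟨r, k, s⟩, hc⟩ hlt hlt' <;> rw [Subtype.mk_lt_mk] at hlt hlt'
    · exact (node_lt_node.1 hlt').not_ge (link_lt_node.1 hlt)
    · rcases link_lt_link.1 hlt with ⟨rfl, rfl, hsp⟩ | hle
      · exact hsp.not_ge (hp s (mem_strand.2 hc))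
      · exact r.lt.not_ge ((link_lt_node.1 hlt').trans hle)

theorem strands_erase_of_ne (hq : q' ≠ q) : strands (X.erase (link q i p)) q' = strands X q' := by
  ext k
  simp [mem_strands, hq]

theorem strands_erase_of_one_lt (hc : 1 < (strand X q i).card) :
    strands (X.erase (link q i p)) q = strands X q := by
  ext k
  simp only [mem_strands, Finset.mem_erase]
  refine ⟨fun ⟨r, hr⟩ => ⟨r, hr.2⟩, fun ⟨r, hr⟩ => ?_⟩
  by_cases hk : k = i
  · obtain ⟨r', hr', hne⟩ := Finset.exists_mem_ne hc p
    exact ⟨r', by simp [hne], hk ▸ mem_strand.1 hr'⟩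
  · exact ⟨r, by simp [hk], hr⟩

theorem strands_erase_subset {x : Web ι} : strands (X.erase x) q ⊆ strands X q := fun k => by
  simp only [mem_strands, Finset.mem_erase]
  exact fun ⟨r, hr⟩ => ⟨r, hr.2⟩

variable [Fintype ι]

theorem excess_width_erase (h : link q i p ∈ X)
    (hc : excess (width X) q = 0 ∨ 1 < (strand X q i).card) :
    excess (width (X.erase (link q i p))) = excess (width X) := by
  funext r
  by_cases hs : strands (X.erase (link q i p)) r = strands X r
  · simp only [excess, width, hs]
  obtain rfl : r = q := by_contra fun hr => hs (strands_erase_of_ne hr)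
  have hq := hc.resolve_right fun hc => hs (strands_erase_of_one_lt hc)
  obtain ⟨hcov, hi⟩ := (excess_width_eq_zero_iff (mem_strands_of_mem h)).1 hq
  have hle : width (X.erase (link r i p)) r ≤ 1 :=
    (Finset.card_le_card strands_erase_subset).trans_eq (by rw [hi, Finset.card_singleton])
  rw [hq, excess, if_pos hcov, Nat.sub_eq_zero_of_le hle]

theorem Reduced.erase (hX : Reduced X) (h : link q i p ∈ X)
    (hc : excess (width X) q = 0 ∨ 1 < (strand X q i).card) : Reduced (X.erase (link q i p)) where
  node_mem v := by simp [hX.node_mem v]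
  isSpanning := excess_width_erase h hc ▸ hX.isSpanning

theorem Reduced.isRetractible_link_of_one_lt (hX : Reduced X) (h : link q i p ∈ X)
    (hc : 1 < (strand X q i).card) : IsRetractible (⟨link q i p, h⟩ : X) := by
  rw [(isIrrStar_link hX.node_mem h).isRetractible_iff]
  intro y z hyx hxz hy hz
  obtain ⟨u, hu⟩ := hX.isRed_iff.1 hy
  obtain ⟨v, hv⟩ := hX.isRed_iff.1 hz
  obtain rfl : y = ⟨node u, hX.node_mem u⟩ := Subtype.ext hu
  obtain rfl : z = ⟨node v, hX.node_mem v⟩ := Subtype.ext hv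
  obtain ⟨r, hr, hne⟩ := Finset.exists_mem_ne hc p
  rw [mem_strand] at hr
  rcases hne.lt_or_gt with hlt | hlt
  · exact absurd (link_lt_link_same.2 ⟨rfl, hlt⟩)
      (hyx.2 (c := ⟨_, hr⟩) (node_lt_link.2 (node_lt_link.1 hyx.lt)))
  · exact absurd (link_lt_node.2 (link_lt_node.1 hxz.lt))
      (hxz.2 (c := ⟨_, hr⟩) (link_lt_link_same.2 ⟨rfl, hlt⟩))

theorem Reduced.isRetractible_link_of_excess_eq_zero (hX : Reduced X) (h : link q i p ∈ X)
    (hq : excess (width X) q = 0) (hs : strand X q i = {p}) :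
    IsRetractible (⟨link q i p, h⟩ : X) := by
  obtain ⟨hcov, hi⟩ := (excess_width_eq_zero_iff (mem_strands_of_mem h)).1 hq
  have hirr := isIrrStar_link hX.node_mem h
  rw [hirr.isRetractible_iff]
  rintro y z hyx hxz - -
  obtain rfl := hirr.1.unique hyx (node_covBy_link hX.node_mem h hs)
  obtain rfl := hirr.2.unique hxz
    ((link_covBy_node_iff hX.node_mem h).2 ⟨rfl, by simp [hs]⟩)
  rintro ⟨v | ⟨r, k, s⟩, hw⟩ hlt hlt' <;> rw [Subtype.mk_lt_mk] at hlt hlt'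
  · exact absurd (node_lt_node.1 hlt') (hcov.2 (node_lt_node.1 hlt))
  · obtain rfl : r = q := Gap.eq_of_covBy hcov (node_lt_link.1 hlt) (link_lt_node.1 hlt')
    obtain rfl : k = i := by simpa [hi] using mem_strands_of_mem hw
    obtain rfl : s = p := by simpa [hs] using mem_strand.2 hw
    rfl

theorem Reduced.isRetractible_link_iff (hX : Reduced X) (h : link q i p ∈ X) :
    IsRetractible (⟨link q i p, h⟩ : X) ↔
      excess (width X) q = 0 ∨ 1 < (strand X q i).card := by
  by_cases hc : 1 < (strand X q i).card
  · exact iff_of_true (hX.isRetractible_link_of_one_lt h hc) (.inr hc)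
  have hs : strand X q i = {p} := Finset.eq_singleton_iff_unique_mem.2
    ⟨mem_strand.2 h, fun r hr => Finset.card_le_one.1 (not_lt.1 hc) _ hr _ (mem_strand.2 h)⟩
  rw [or_iff_left hc]
  refine ⟨fun hr => ?_, fun hq => hX.isRetractible_link_of_excess_eq_zero h hq hs⟩
  by_contra hq
  rw [(isIrrStar_link hX.node_mem h).isRetractible_iff] at hr
  have hunique := hr _ _ (node_covBy_link hX.node_mem h hs)
    ((link_covBy_node_iff hX.node_mem h).2 ⟨rfl, by simp [hs]⟩)
    (hX.isRed_node _) (hX.isRed_node _)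
  obtain ⟨a, ha, b, hb, ⟨hva, hvb, hav, hbv⟩, hab, -⟩ := exists_mem_of_excess_ne_zero hX.node_mem hq
  have ha' := hunique ⟨a, ha⟩ hva hav
  have hb' := hunique ⟨b, hb⟩ hvb hbv
  obtain rfl : a = b := Subtype.ext_iff.1 (ha'.trans hb'.symm)
  exact hab a le_rfl le_rfl hav

/-- The number of strands over each gap of a basic block with the given excess. -/
def basicWidth (e : Gap ι → ℕ) (q : Gap ι) : ℕ :=
  if e q = 0 then 0 else if q.src ⋖ q.tgt then e q + 1 else e q

theorem excess_basicWidth (e : Gap ι → ℕ) : excess (basicWidth e) = e := by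
  funext q
  rw [excess, basicWidth]
  split_ifs <;> omega

theorem Reduced.sizes_of_isBasicRetract (hX : Reduced X) (hb : IsBasicRetract X) :
    sizes X = fun q => Multiset.replicate (basicWidth (excess (width X)) q) 1 := by
  have hlink {q i p} (h : link q i p ∈ X) :
      excess (width X) q ≠ 0 ∧ ¬ 1 < (strand X q i).card := by
    rw [← not_or, ← hX.isRetractible_link_iff h]
    exact hb _ (isIrrStar_link hX.node_mem h)
  have hwidth q : basicWidth (excess (width X)) q = width X q := by
    by_cases hw : width X q = 0
    · simp [basicWidth, excess, hw]
    · obtain ⟨i, p, h⟩ := width_ne_zero_iff.1 hw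
      have hq := (hlink h).1
      rw [basicWidth, if_neg hq]
      rw [excess] at hq ⊢
      split_ifs at hq ⊢ <;> omega
  funext q
  rw [Multiset.eq_replicate, card_sizes, hwidth]
  refine ⟨rfl, fun n hn => ?_⟩
  obtain ⟨i, hi, rfl⟩ := Multiset.mem_map.1 hn
  obtain ⟨p, h⟩ := mem_strands.1 hi
  have hpos := Finset.card_pos.2 (strand_nonempty.2 hi)
  have := (hlink h).2
  omega

/-! ### The associated basic block -/

/-- The reducible elements of `α` form a chain isomorphic to `ι`, and `α` is isomorphic to a finite
part of the web over `ι` of excess `e`. -/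
def HasExcess (α : Type*) [PartialOrder α] (e : Gap ι → ℕ) : Prop :=
  ∃ X : Finset (Web ι), Reduced X ∧ excess (width X) = e ∧ Nonempty (α ≃o X)

variable {α : Type*} [PartialOrder α] {S T B : Set α} {e : Gap ι → ℕ}

omit [Fintype ι] in
theorem nonempty_orderIso_erase (g : S ≃o X) (x : S) :
    Nonempty (↥(S \ {x.1}) ≃o X.erase (g x).1) := by
  refine ⟨⟨⟨fun a => ⟨g ⟨a, a.2.1⟩, Finset.mem_erase.2 ⟨?_, Subtype.prop _⟩⟩,
    fun b => ⟨g.symm ⟨b, Finset.mem_of_mem_erase b.2⟩, Subtype.prop _, ?_⟩,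
    fun a => by simp, fun b => by simp⟩, ?_⟩⟩
  · rw [Ne, Subtype.coe_inj, g.injective.eq_iff, Subtype.ext_iff]
    exact a.2.2
  · rw [Set.mem_singleton_iff, Subtype.coe_inj, ← g.injective.eq_iff, g.apply_symm_apply,
      Subtype.ext_iff]
    exact Finset.ne_of_mem_erase b.2
  · exact g.le_iff_le

theorem HasExcess.retractStep (hS : HasExcess S e) (h : RetractStep S T) : HasExcess T e := by
  obtain ⟨X, hX, rfl, ⟨g⟩⟩ := hS
  obtain ⟨x, hx, hr, rfl⟩ := h
  have : Finite S := Finite.of_equiv _ g.symm.toEquiv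
  obtain ⟨g'⟩ := nonempty_orderIso_erase g x
  rw [← hx.isRetractible_orderIso_iff g] at hr
  rw [← isIrrStar_orderIso_iff g] at hx
  generalize g x = y at hr hx g'
  obtain ⟨v | ⟨q, i, p⟩, h⟩ := y
  · exact absurd hx.isIrr (hX.isRed_node v)
  · have hc := (hX.isRetractible_link_iff h).1 hr
    exact ⟨X.erase (link q i p), hX.erase h hc, excess_width_erase h hc, ⟨g'⟩⟩

theorem HasExcess.not_isPendant (h : HasExcess α e) (x : α) : ¬ IsPendant x := by
  obtain ⟨X, hX, -, ⟨g⟩⟩ := h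
  rcases hX.isRed_or_isIrrStar (g x) with hx | hx
  · exact ((isRed_orderIso_iff g).1 hx).not_isPendant
  · exact ((isIrrStar_orderIso_iff g).1 hx).not_isPendant

theorem HasExcess.of_isAssociatedBasicRetract (h : HasExcess α e)
    (hB : IsAssociatedBasicRetract B) : HasExcess B e := by
  have huniv : HasExcess (Set.univ : Set α) e := by
    obtain ⟨X, hX, he, ⟨g⟩⟩ := h
    exact ⟨X, hX, he, ⟨OrderIso.Set.univ.trans g⟩⟩
  obtain ⟨hB, -⟩ := hB
  induction hB with
  | refl => exact huniv
  | tail _ hstep ih => exact ih.retractStep hstep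

theorem HasExcess.isAssociatedBasicBlock_iff (h : HasExcess α e) :
    IsAssociatedBasicBlock B ↔ IsAssociatedBasicRetract B := by
  constructor
  · rintro ⟨R, hR, hRB, -⟩
    rcases hRB.cases_head with rfl | ⟨T, ⟨x, hx, -⟩, -⟩
    · exact hR
    · exact absurd hx ((h.of_isAssociatedBasicRetract hR).not_isPendant x)
  · exact fun hB => ⟨B, hB, .refl, (h.of_isAssociatedBasicRetract hB).not_isPendant⟩

theorem HasExcess.exists_isAssociatedBasicBlock (h : HasExcess α e) :
    ∃ B : Set α, IsAssociatedBasicBlock B := by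
  obtain ⟨X, -, -, ⟨g⟩⟩ := id h
  have : Finite α := Finite.of_equiv _ g.symm.toEquiv
  obtain ⟨R, hR, hb⟩ := exists_isBasicRetract_of_retractSteps (Set.univ : Set α)
  exact ⟨R, h.isAssociatedBasicBlock_iff.2 ⟨hR, hb⟩⟩

theorem HasExcess.exists_orderIso_basicBlock (h : HasExcess α e) (hB : IsAssociatedBasicBlock B) :
    ∃ Y : Finset (Web ι), (∀ v, node v ∈ Y) ∧
      (sizes Y = fun q => Multiset.replicate (basicWidth e q) 1) ∧ Nonempty (B ≃o Y) := by
  rw [h.isAssociatedBasicBlock_iff] at hB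
  obtain ⟨Y, hY, rfl, ⟨g⟩⟩ := h.of_isAssociatedBasicRetract hB
  exact ⟨Y, hY.node_mem, hY.sizes_of_isBasicRetract ((isBasicRetract_congr g.symm).1 hB.2), ⟨g⟩⟩

end Web

/-! ### The height of the basic block -/

namespace Web

variable {ι : Type*} [LinearOrder ι] [Fintype ι] {Y : Finset (Web ι)} {n : Gap ι → ℕ} {q : Gap ι}

/-- The nonempty consecutive gaps. -/
def occupied (n : Gap ι → ℕ) : Finset (Gap ι) := {q | q.src ⋖ q.tgt ∧ n q ≠ 0}

/-- The height of `node v` in a part of the web with `n q` one-element strands over each gap `q`. -/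
def nodeRank (n : Gap ι → ℕ) (v : ι) : ℕ :=
  Finset.card {u | u < v} + ((occupied n).filter (·.tgt ≤ v)).card

theorem nodeRank_add_one_le {u v : ι} (h : u < v) : nodeRank n u + 1 ≤ nodeRank n v := by
  have hlt : Finset.card {w | w < u} < Finset.card {w | w < v} := Finset.card_lt_card <| by
    rw [Finset.ssubset_iff_of_subset (Finset.monotone_filter_right _ fun _ _ hw => hw.trans h)]
    exact ⟨u, by simpa⟩
  have hle : ((occupied n).filter (·.tgt ≤ u)).card ≤ ((occupied n).filter (·.tgt ≤ v)).card :=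
    Finset.card_le_card (Finset.monotone_filter_right _ fun _ _ hq => hq.trans h.le)
  simp only [nodeRank]
  omega

theorem nodeRank_strictMono : StrictMono (nodeRank n) := fun _ _ => nodeRank_add_one_le

theorem nodeRank_tgt_of_covBy (hq : q.src ⋖ q.tgt) :
    nodeRank n q.tgt = nodeRank n q.src + 1 + if n q = 0 then 0 else 1 := by
  have hnodes : Finset.univ.filter (· < q.tgt) = insert q.src (Finset.univ.filter (· < q.src)) := by
    ext u
    simp [hq.lt_iff_le_left, le_iff_eq_or_lt]
  have hgaps : (occupied n).filter (·.tgt ≤ q.tgt) =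
      (occupied n).filter (·.tgt ≤ q.src) ∪ if n q = 0 then ∅ else {q} := by
    ext r
    have hr : r.tgt ≤ q.tgt ↔ r.tgt ≤ q.src ∨ r.tgt = q.tgt := by
      rw [le_iff_lt_or_eq, hq.lt_iff_le_left]
    have hrq : r.src ⋖ r.tgt → r.tgt = q.tgt → r = q := fun hr h =>
      Gap.ext (hr.unique_left (h ▸ hq)) h
    simp only [occupied, Finset.mem_filter, Finset.mem_union, Finset.mem_univ, true_and, hr]
    split_ifs <;> grind
  have hnot : q ∉ (occupied n).filter (·.tgt ≤ q.src) := by simp [q.lt]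
  rw [nodeRank, nodeRank, hnodes, hgaps, Finset.card_insert_of_notMem (by simp)]
  split_ifs
  · simp [add_right_comm]
  · rw [Finset.card_union_of_disjoint (by simpa using hnot), Finset.card_singleton]
    ring

theorem nodeRank_src_add_two_le (hq : n q ≠ 0) :
    nodeRank n q.src + 2 ≤ nodeRank n q.tgt := by
  by_cases hcov : q.src ⋖ q.tgt
  · rw [nodeRank_tgt_of_covBy hcov, if_neg hq]
  · obtain ⟨w, hw, hw'⟩ := exists_lt_lt_of_not_covBy q.lt hcov
    have := nodeRank_add_one_le (n := n) hw
    have := nodeRank_add_one_le (n := n) hw'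
    omega

theorem nodeRank_of_isTop {t : ι} (ht : IsTop t) :
    nodeRank n t = Fintype.card ι - 1 + (occupied n).card := by
  have hnodes : Finset.univ.filter (· < t) = Finset.univ.erase t := by
    ext u
    simp [(ht u).lt_iff_ne]
  rw [nodeRank, hnodes, Finset.card_erase_of_mem (Finset.mem_univ t), Finset.card_univ,
    Finset.filter_true_of_mem fun q _ => ht q.tgt]

theorem krullDim_le_nodeRank (hstrand : ∀ q, ∀ s ∈ sizes Y q, s ≤ 1) {t : ι} (ht : IsTop t) :
    Order.krullDim Y ≤ (nodeRank (width Y) t : WithBot ℕ∞) := by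
  let rank : Y → ℕ
    | ⟨node v, _⟩ => nodeRank (width Y) v
    | ⟨link q _ _, _⟩ => nodeRank (width Y) q.src + 1
  have htgt {q i p} (h : link q i p ∈ Y) :
      nodeRank (width Y) q.src + 1 < nodeRank (width Y) q.tgt :=
    nodeRank_src_add_two_le (width_ne_zero_iff.2 ⟨i, p, h⟩)
  have hrank : StrictMono rank := by
    have hmono := nodeRank_strictMono (n := width Y)
    rintro ⟨v | ⟨q, i, p⟩, hx⟩ ⟨w | ⟨r, k, s⟩, hy⟩ h <;> rw [Subtype.mk_lt_mk] at h
    · exact hmono (node_lt_node.1 h)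
    · exact Nat.lt_succ_of_le (hmono.monotone (node_lt_link.1 h))
    · exact (htgt hx).trans_le (hmono.monotone (link_lt_node.1 h))
    · rcases link_lt_link.1 h with ⟨rfl, rfl, hlt⟩ | h
      · exact absurd (Finset.card_le_one.1 (hstrand q _ (Multiset.mem_map_of_mem _
          (mem_strands_of_mem hx))) _ (mem_strand.2 hx) _ (mem_strand.2 hy)) hlt.ne
      · exact ((htgt hx).trans_le (hmono.monotone h)).trans (Nat.lt_succ_self _)
  have hle (x : Y) : rank x ≤ nodeRank (width Y) t := by
    obtain ⟨v | ⟨q, i, p⟩, hx⟩ := x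
    · exact nodeRank_strictMono.monotone (ht v)
    · exact (htgt hx).le.trans (nodeRank_strictMono.monotone (ht q.tgt))
  refine iSup_le fun l => ?_
  have := (l.map rank hrank).head_add_length_le_nat
  rw [LTSeries.last_map, LTSeries.map_length] at this
  exact_mod_cast (by omega : l.length ≤ rank l.last).trans (hle _)

omit [Fintype ι] in
theorem exists_gap_covBy [Finite ι] {v : ι} (hv : ¬ IsMin v) :
    ∃ q : Gap ι, q.src ⋖ q.tgt ∧ q.tgt = v := by
  obtain ⟨u, hu⟩ := not_isMin_iff.1 hv
  obtain ⟨w, -, hw⟩ := exists_le_covBy_of_lt hu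
  exact ⟨⟨w, v, hw.lt⟩, hw, rfl⟩

theorem nodeRank_le_height (hY : ∀ v, node v ∈ Y) (v : ι) :
    nodeRank (width Y) v ≤ Order.height (⟨node v, hY v⟩ : Y) := by
  induction v using WellFoundedLT.induction with | _ v ih
  by_cases hv : IsMin v
  · have hlt (w : ι) : ¬ w < v := hv.not_lt
    have hgap (q : Gap ι) : ¬ q.tgt ≤ v := fun h => hlt _ (q.lt.trans_le h)
    simp [nodeRank, hlt, hgap]
  obtain ⟨q, hq, rfl⟩ := exists_gap_covBy hv
  rw [nodeRank_tgt_of_covBy hq]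
  split_ifs with hw
  · rw [add_zero, Nat.cast_add, Nat.cast_one]
    exact (add_le_add_left (ih _ q.lt) 1).trans (Order.height_add_one_le (node_lt_node.2 q.lt))
  · obtain ⟨i, p, h⟩ := width_ne_zero_iff.1 hw
    have hsrc : Order.height (⟨node q.src, hY _⟩ : Y) + 1 ≤ Order.height (⟨_, h⟩ : Y) :=
      Order.height_add_one_le (node_lt_link.2 le_rfl)
    have htgt : Order.height (⟨_, h⟩ : Y) + 1 ≤ Order.height (⟨node q.tgt, hY _⟩ : Y) :=
      Order.height_add_one_le (link_lt_node.2 le_rfl)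
    rw [Nat.cast_add, Nat.cast_add, Nat.cast_one]
    exact (add_le_add_left ((add_le_add_left (ih _ q.lt) 1).trans hsrc) 1).trans htgt

theorem krullDim_eq_of_sizes_le_one [Nonempty ι] (hY : ∀ v, node v ∈ Y)
    (hstrand : ∀ q, ∀ s ∈ sizes Y q, s ≤ 1) :
    Order.krullDim Y = (Fintype.card ι - 1 + (occupied (width Y)).card : ℕ) := by
  obtain ⟨t, ht⟩ := Finite.exists_max (id : ι → ι)
  rw [← nodeRank_of_isTop ht]
  refine (krullDim_le_nodeRank hstrand ht).antisymm ?_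
  exact (by exact_mod_cast nodeRank_le_height hY t : _ ≤ _).trans (Order.height_le_krullDim _)

theorem basicWidth_eq_zero_iff {e : Gap ι → ℕ} : basicWidth e q = 0 ↔ e q = 0 := by
  rw [basicWidth]
  split_ifs <;> simp_all

theorem HasExcess.krullDim_basicBlock [Nonempty ι] {α : Type*} [PartialOrder α] {B : Set α}
    {e : Gap ι → ℕ} (h : HasExcess α e) (hB : IsAssociatedBasicBlock B) :
    Order.krullDim B = (Fintype.card ι - 1 + (occupied e).card : ℕ) := by
  obtain ⟨Y, hY, hs, ⟨g⟩⟩ := h.exists_orderIso_basicBlock hB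
  have hocc : occupied (width Y) = occupied e := by
    simp only [occupied, width_eq_card_sizes, hs, Multiset.card_replicate, ne_eq,
      basicWidth_eq_zero_iff]
  rw [Order.krullDim_eq_of_orderIso g, ← hocc]
  refine krullDim_eq_of_sizes_le_one hY fun q s hq => ?_
  rw [hs] at hq
  exact (Multiset.eq_of_mem_replicate hq).le

end Web

/-! ### Nullity -/

theorem ncard_covBy_of_existsUnique {α : Type*} [PartialOrder α] {T : Set α}
    (h : ∀ x ∈ T, ∃! y, y ⋖ x) : {p : α × α | p.1 ⋖ p.2 ∧ p.2 ∈ T}.ncard = T.ncard := by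
  refine (Set.InjOn.ncard_image (f := Prod.snd) ?_).symm.trans (congrArg _ ?_)
  · rintro ⟨a, x⟩ ⟨ha, hx⟩ ⟨b, _⟩ ⟨hb, -⟩ rfl
    exact Prod.ext ((h x hx).unique ha hb) rfl
  · ext x
    simp only [Set.mem_image, Set.mem_ofPred_eq, Prod.exists, exists_eq_right]
    exact ⟨fun ⟨_, _, hx⟩ => hx, fun hx => (h x hx).exists.imp fun _ ha => ⟨ha, hx⟩⟩

namespace Web

variable {ι : Type*} [LinearOrder ι] {X : Finset (Web ι)} {q : Gap ι}

theorem node_covBy_node_iff (hX : ∀ v, node v ∈ X) :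
    (⟨node q.src, hX _⟩ : X) ⋖ ⟨node q.tgt, hX _⟩ ↔ q.src ⋖ q.tgt ∧ width X q = 0 := by
  constructor
  · intro hc
    refine ⟨⟨q.lt, fun u hu hu' => hc.2 (c := ⟨_, hX u⟩) (node_lt_node.2 hu) (node_lt_node.2 hu')⟩,
      not_ne_iff.1 fun hw => ?_⟩
    obtain ⟨i, p, h⟩ := width_ne_zero_iff.1 hw
    exact hc.2 (c := ⟨_, h⟩) (node_lt_link.2 le_rfl) (link_lt_node.2 le_rfl)
  · rintro ⟨hq, hw⟩
    refine ⟨node_lt_node.2 q.lt, ?_⟩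
    rintro ⟨v | ⟨r, i, p⟩, h⟩ hlt hlt' <;> rw [Subtype.mk_lt_mk] at hlt hlt'
    · exact hq.2 (node_lt_node.1 hlt) (node_lt_node.1 hlt')
    · obtain rfl : r = q := Gap.eq_of_covBy hq (node_lt_link.1 hlt) (link_lt_node.1 hlt')
      exact width_ne_zero_iff.2 ⟨i, p, h⟩ hw

variable [Fintype ι]

theorem ncard_links_add_card (hX : ∀ v, node v ∈ X) :
    {x : X | ∀ v, x.1 ≠ node v}.ncard + Fintype.card ι = X.card := by
  have hnodes : {x : X | ∀ v, x.1 ≠ node v}ᶜ = Set.range fun v => (⟨node v, hX v⟩ : X) := by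
    ext x
    simp [Subtype.ext_iff, eq_comm]
  have hinj : Function.Injective fun v => (⟨node v, hX v⟩ : X) := fun v w h => by simpa using h
  have hcard := Set.ncard_add_ncard_compl {x : X | ∀ v, x.1 ≠ node v}
  rwa [hnodes, ← Set.image_univ, Set.ncard_image_of_injective _ hinj, Set.ncard_univ,
    Nat.card_eq_fintype_card, Nat.card_eq_fintype_card, Fintype.card_coe] at hcard

theorem ncard_link_covBy_node (hX : ∀ v, node v ∈ X) :
    {p : X × X | p.1 ⋖ p.2 ∧ (∀ v, p.1.1 ≠ node v) ∧ ∃ v, p.2.1 = node v}.ncard =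
      ∑ q, width X q := by
  let top (s : Σ _ : Gap ι, ℕ) : Web ι × Web ι :=
    (link s.1 s.2 ((strand X s.1 s.2).sup id), node s.1.tgt)
  have htop : Function.Injective top := by
    rintro ⟨q, i⟩ ⟨r, j⟩ h
    simp_all [top]
  have hsup {q i} (hi : i ∈ strands X q) : link q i ((strand X q i).sup id) ∈ X := by
    obtain ⟨p, hp, hs⟩ := Finset.exists_mem_eq_sup _ (strand_nonempty.2 hi) id
    exact hs ▸ mem_strand.1 hp
  have himage : Prod.map Subtype.val Subtype.val ''
      {p : X × X | p.1 ⋖ p.2 ∧ (∀ v, p.1.1 ≠ node v) ∧ ∃ v, p.2.1 = node v} =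
        top '' (Finset.univ.sigma (strands X) : Finset (Σ _ : Gap ι, ℕ)) := by
    ext x
    constructor
    · rintro ⟨⟨⟨u | ⟨q, i, p⟩, hp⟩, ⟨_, hy⟩⟩, ⟨hc, hnode, v, rfl⟩, rfl⟩
      · exact absurd rfl (hnode u)
      · obtain ⟨rfl, hmax⟩ := (link_covBy_node_iff hX hp).1 hc
        have hs : (strand X q i).sup id = p :=
          (Finset.sup_le hmax).antisymm (Finset.le_sup (f := id) (mem_strand.2 hp))
        exact ⟨⟨q, i⟩, by simpa using mem_strands_of_mem hp, by simp [top, hs]⟩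
    · rintro ⟨⟨q, i⟩, hi, rfl⟩
      have hi : i ∈ strands X q := by simpa using hi
      exact ⟨(⟨_, hsup hi⟩, ⟨_, hX _⟩), ⟨(link_covBy_node_iff hX _).2
        ⟨rfl, fun r hr => Finset.le_sup (f := id) hr⟩, by simp, _, rfl⟩, rfl⟩
  rw [← Set.ncard_image_of_injective _ (Subtype.val_injective.prodMap Subtype.val_injective),
    himage, Set.ncard_image_of_injective _ htop, Set.ncard_coe_finset, Finset.card_sigma]
  rfl

theorem ncard_node_covBy_node (hX : ∀ v, node v ∈ X) :
    {p : X × X | p.1 ⋖ p.2 ∧ (∃ v, p.1.1 = node v) ∧ ∃ v, p.2.1 = node v}.ncard =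
      Finset.card {q : Gap ι | q.src ⋖ q.tgt ∧ width X q = 0} := by
  let ends (q : Gap ι) : X × X := (⟨node q.src, hX _⟩, ⟨node q.tgt, hX _⟩)
  have hends : Function.Injective ends := fun q r h => Gap.ext (by simp_all [ends])
    (by simp_all [ends])
  rw [← Set.ncard_coe_finset, ← Set.ncard_image_of_injective _ hends]
  congr 1
  ext x
  constructor
  · rintro ⟨hc, ⟨u, hu⟩, v, hv⟩
    obtain ⟨⟨_, hx⟩, ⟨_, hy⟩⟩ := x
    obtain rfl := hu
    obtain rfl := hv
    let q : Gap ι := ⟨u, v, node_lt_node.1 hc.lt⟩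
    exact ⟨q, by simpa using (node_covBy_node_iff (q := q) hX).1 hc, rfl⟩
  · rintro ⟨q, hq, rfl⟩
    exact ⟨(node_covBy_node_iff hX).2 (by simpa using hq), ⟨_, rfl⟩, _, rfl⟩

theorem ncard_covBy_add_card (hX : ∀ v, node v ∈ X) :
    {p : X × X | p.1 ⋖ p.2}.ncard + Fintype.card ι = X.card + ∑ q, width X q +
      Finset.card {q : Gap ι | q.src ⋖ q.tgt ∧ width X q = 0} := by
  have hlink := ncard_covBy_of_existsUnique (T := {x : X | ∀ v, x.1 ≠ node v}) <| by
    rintro ⟨v | ⟨q, i, p⟩, h⟩ hx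
    · exact absurd rfl (hx v)
    · exact (isIrrStar_link hX h).1
  have hsplit : {p : X × X | p.1 ⋖ p.2} =
      {p | p.1 ⋖ p.2 ∧ p.2 ∈ {x : X | ∀ v, x.1 ≠ node v}} ∪
      ({p | p.1 ⋖ p.2 ∧ (∀ v, p.1.1 ≠ node v) ∧ ∃ v, p.2.1 = node v} ∪
      {p | p.1 ⋖ p.2 ∧ (∃ v, p.1.1 = node v) ∧ ∃ v, p.2.1 = node v}) := by
    ext p
    simp only [Set.mem_union, Set.mem_ofPred_eq]
    grind
  rw [hsplit, Set.ncard_union_eq, Set.ncard_union_eq, hlink, ncard_link_covBy_node hX,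
    ncard_node_covBy_node hX, ← ncard_links_add_card hX]
  · ring
  all_goals
    rw [Set.disjoint_left]
    simp only [Set.mem_union, Set.mem_ofPred_eq]
    grind

theorem card_covBy_gaps_add_one [Nonempty ι] :
    Finset.card {q : Gap ι | q.src ⋖ q.tgt} + 1 = Fintype.card ι := by
  obtain ⟨b, hb⟩ := Finite.exists_min (id : ι → ι)
  have himage : ({q : Gap ι | q.src ⋖ q.tgt} : Finset (Gap ι)).image Gap.tgt =
      Finset.univ.erase b := by
    ext v
    simp only [Finset.mem_image, Finset.mem_filter, Finset.mem_univ, true_and, Finset.mem_erase,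
      and_true]
    constructor
    · rintro ⟨q, -, rfl⟩
      exact ((hb _).trans_lt q.lt).ne'
    · exact fun hv => exists_gap_covBy fun hmin => hv ((hmin.eq_of_ge (hb v)))
  rw [← Finset.card_image_of_injOn (f := Gap.tgt), himage,
    Finset.card_erase_add_one (Finset.mem_univ b), Finset.card_univ]
  simp only [Set.InjOn, Finset.coe_filter, Finset.mem_univ, true_and, Set.mem_ofPred_eq]
  exact fun q hq r hr h => Gap.ext (hq.unique_left (h ▸ hr)) h

theorem sum_width_add_card_empty (n : Gap ι → ℕ) :
    ∑ q, n q + Finset.card {q : Gap ι | q.src ⋖ q.tgt ∧ n q = 0} =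
      ∑ q, excess n q + Finset.card {q : Gap ι | q.src ⋖ q.tgt} := by
  simp only [Finset.card_filter, ← Finset.sum_add_distrib]
  refine Finset.sum_congr rfl fun q _ => ?_
  by_cases hq : q.src ⋖ q.tgt <;> by_cases hn : n q = 0 <;> simp [excess, hq, hn]
  omega

theorem HasExcess.nullity_eq [Nonempty ι] {α : Type*} [PartialOrder α] {e : Gap ι → ℕ}
    (h : HasExcess α e) : nullity α = ((∑ q, e q : ℕ) : ℤ) := by
  obtain ⟨X, hX, rfl, ⟨g⟩⟩ := h
  obtain ⟨b, hb⟩ := Finite.exists_min (id : ι → ι)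
  have hbot : IsBot (⟨node b, hX.node_mem b⟩ : X) := by
    rintro ⟨v | ⟨q, i, p⟩, _⟩
    · exact node_le_node.2 (hb v)
    · exact node_le_link.2 (hb q.src)
  have hcovers := ncard_covBy_add_card hX.node_mem
  have hwidth := sum_width_add_card_empty (width X)
  have hgaps := card_covBy_gaps_add_one (ι := ι)
  rw [nullity_congr g, nullity_of_isBot hbot, Nat.card_eq_fintype_card, Fintype.card_coe]
  omega

end Web

/-! ### Embedding a block into the web -/

theorem exists_orderEmbedding_fin_of_isChain {α : Type*} [PartialOrder α] {s : Set α}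
    (hs : IsChain (· ≤ ·) s) (hf : s.Finite) : ∃ r : Fin s.ncard ↪o α, Set.range r = s := by
  classical
  let _ : LinearOrder s := hs.linearOrder
  have := hf.fintype
  let e : Fin s.ncard ≃o s :=
    Fintype.orderIsoFinOfCardEq s (Nat.card_eq_fintype_card.symm.trans (Nat.card_coe_set_eq s))
  refine ⟨e.toOrderEmbedding.trans (OrderEmbedding.subtype _), ?_⟩
  exact (e.surjective.range_comp Subtype.val).trans Subtype.range_coe

section Strands

variable {α : Type*} [Lattice α] {x y z : α}

/-- `x ≤ y` lie on a common strand of a lattice whose reducible elements form a chain: no reducible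
element separates them. -/
def IrredBelow (x y : α) : Prop := x ≤ y ∧ ∀ w, x ≤ w → w ≤ y → ¬ IsReducible w

theorem IrredBelow.le_or_le_of_le_right (h : IrredBelow x y) (hz : z ≤ y) : x ≤ z ∨ z ≤ x := by
  by_contra! hxz
  exact h.2 _ le_sup_left (sup_le h.1 hz)
    (.inr ⟨x, z, fun h => hxz.2 (h ▸ le_sup_right), fun h => hxz.1 (h ▸ le_sup_left), rfl⟩)

theorem IrredBelow.le_or_le_of_le_left (h : IrredBelow x y) (hz : x ≤ z) : y ≤ z ∨ z ≤ y := by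
  by_contra! hyz
  exact h.2 _ (le_inf h.1 hz) inf_le_left
    (.inl ⟨y, z, fun h => hyz.1 (h ▸ inf_le_right), fun h => hyz.2 (h ▸ inf_le_left), rfl⟩)

theorem IrredBelow.trans (hxy : IrredBelow x y) (hyz : IrredBelow y z) : IrredBelow x z :=
  ⟨hxy.1.trans hyz.1, fun w hxw hwz =>
    (hxy.le_or_le_of_le_left hxw).elim (fun hyw => hyz.2 w hyw hwz) (hxy.2 w hxw)⟩

theorem IrredBelow.comparable_of_right (hx : IrredBelow x z) (hy : IrredBelow y z) :
    IrredBelow x y ∨ IrredBelow y x :=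
  (hx.le_or_le_of_le_right hy.1).imp
    (fun hxy => ⟨hxy, fun w hxw hwy => hx.2 w hxw (hwy.trans hy.1)⟩)
    fun hyx => ⟨hyx, fun w hyw hwx => hy.2 w hyw (hwx.trans hx.1)⟩

theorem IrredBelow.comparable_of_left (hx : IrredBelow z x) (hy : IrredBelow z y) :
    IrredBelow x y ∨ IrredBelow y x :=
  (hx.le_or_le_of_le_left hy.1).imp
    (fun hxy => ⟨hxy, fun w hxw hwy => hy.2 w (hx.1.trans hxw) hwy⟩)
    fun hyx => ⟨hyx, fun w hyw hwx => hx.2 w (hy.1.trans hyw) hwx⟩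

variable (α) in
/-- The partition of the irreducible elements into strands. -/
def strandSetoid : Setoid {x : α // ¬ IsReducible x} where
  r x y := IrredBelow x.1 y.1 ∨ IrredBelow y.1 x.1
  iseqv :=
    { refl x := .inl ⟨le_rfl, fun _ hxw hwx => le_antisymm hxw hwx ▸ x.2⟩
      symm := Or.symm
      trans := by
        rintro x y z (hxy | hyx) (hyz | hzy)
        · exact .inl (hxy.trans hyz)
        · exact hxy.comparable_of_right hzy
        · exact hyx.comparable_of_left hyz
        · exact .inr (hzy.trans hyx) }

variable {ι : Type*} [LinearOrder ι] {r : ι ↪o α} {q q' : Gap ι}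

/-- `q` is the gap between the reducible elements `r v` below and above `x`. -/
structure LiesOver (r : ι ↪o α) (q : Gap ι) (x : α) : Prop where
  le_iff : ∀ {v}, r v ≤ x ↔ v ≤ q.src
  ge_iff : ∀ {v}, x ≤ r v ↔ q.tgt ≤ v

theorem exists_forall_map_le_iff [Finite ι] (h : ∃ v, r v ≤ x) : ∃ s, ∀ {v}, r v ≤ x ↔ v ≤ s := by
  obtain ⟨s, hs⟩ := (Set.toFinite {v | r v ≤ x}).exists_maximal h
  exact ⟨s, fun {v} => ⟨fun hv => (le_total v s).elim id (hs.2 hv),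
    fun hv => (r.monotone hv).trans hs.1⟩⟩

theorem exists_forall_le_map_iff [Finite ι] (h : ∃ v, x ≤ r v) : ∃ t, ∀ {v}, x ≤ r v ↔ t ≤ v := by
  obtain ⟨t, ht⟩ := (Set.toFinite {v | x ≤ r v}).exists_minimal h
  exact ⟨t, fun {v} => ⟨fun hv => (le_total t v).elim id (ht.2 hv),
    fun hv => ht.1.trans (r.monotone hv)⟩⟩

theorem exists_liesOver [Finite ι] (hx : x ∉ Set.range r) (hlower : ∃ v, r v ≤ x)
    (hupper : ∃ v, x ≤ r v) : ∃ q, LiesOver r q x := by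
  obtain ⟨s, hs⟩ := exists_forall_map_le_iff hlower
  obtain ⟨t, ht⟩ := exists_forall_le_map_iff hupper
  have hsx : r s ≤ x := hs.2 le_rfl
  have hxt : x ≤ r t := ht.2 le_rfl
  refine ⟨⟨s, t, (r.le_iff_le.1 (hsx.trans hxt)).lt_of_ne ?_⟩, ⟨hs, ht⟩⟩
  rintro rfl
  exact hx ⟨s, hsx.antisymm hxt⟩

theorem LiesOver.eq_of_irredBelow (hr : ∀ v, IsReducible (r v)) (hx : LiesOver r q x)
    (hy : LiesOver r q' y) (h : IrredBelow x y) : q = q' := by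
  have hsrc : r q'.src ≤ y := hy.le_iff.2 le_rfl
  have htgt : x ≤ r q.tgt := hx.ge_iff.2 le_rfl
  refine Gap.ext (le_antisymm (hy.le_iff.1 ((hx.le_iff.2 le_rfl).trans h.1)) (hx.le_iff.1 ?_))
    (le_antisymm (hx.ge_iff.1 (h.1.trans (hy.ge_iff.2 le_rfl))) (hy.ge_iff.1 ?_))
  · exact (h.le_or_le_of_le_right hsrc).resolve_left fun hle => h.2 _ hle hsrc (hr _)
  · exact (h.le_or_le_of_le_left htgt).resolve_right fun hle => h.2 _ htgt hle (hr _)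

theorem LiesOver.le_iff_irredBelow_or (hr : ∀ a, IsReducible a ↔ a ∈ Set.range r)
    (hx : LiesOver r q x) (hy : LiesOver r q' y) :
    x ≤ y ↔ IrredBelow x y ∨ q.tgt ≤ q'.src := by
  constructor
  · intro hxy
    by_cases h : ∀ w, x ≤ w → w ≤ y → ¬ IsReducible w
    · exact .inl ⟨hxy, h⟩
    · push Not at h
      obtain ⟨w, hxw, hwy, hw⟩ := h
      obtain ⟨v, rfl⟩ := (hr w).1 hw
      exact .inr ((hx.ge_iff.1 hxw).trans (hy.le_iff.1 hwy))
  · rintro (h | h)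
    exacts [h.1, (hx.ge_iff.2 h).trans (hy.le_iff.2 le_rfl)]

theorem irredBelow_iff_of_strictMono {pos : α → ℕ} (hpos : StrictMono pos)
    (x y : {x : α // ¬ IsReducible x}) :
    IrredBelow x.1 y.1 ↔ strandSetoid α x y ∧ pos x ≤ pos y := by
  refine ⟨fun h => ⟨.inl h, hpos.monotone h.1⟩, ?_⟩
  rintro ⟨h | h, hle⟩
  · exact h
  · obtain rfl : y = x := Subtype.ext (h.1.eq_of_not_lt fun hlt => (hpos hlt).not_ge hle)
    exact h

open Web

/-- An irreducible element goes to the gap it lies over, the number of its strand, and a position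
on that strand that may be read off any strictly monotone function. -/
theorem exists_orderEmbedding_web [Finite α] (hr : ∀ a, IsReducible a ↔ a ∈ Set.range r)
    (hlower : ∀ x, ∃ v, r v ≤ x) (hupper : ∀ x, ∃ v, x ≤ r v) :
    ∃ f : α ↪o Web ι, ∀ v, f (r v) = node v := by
  classical
  have : Finite ι := Finite.of_injective r r.injective
  have hover (x : {x : α // ¬ IsReducible x}) : ∃ q, LiesOver r q x.1 :=
    exists_liesOver (fun h => x.2 ((hr _).2 h)) (hlower _) (hupper _)
  choose gap hgap using hover
  obtain ⟨index, hindex⟩ := exists_injective_nat (Quotient (strandSetoid α))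
  let pos (x : α) : ℕ := (Set.Iio x).ncard
  have hpos : StrictMono pos := fun _ _ h => Set.ncard_lt_ncard (Set.Iio_ssubset_Iio h)
  let link' (x : {x : α // ¬ IsReducible x}) : Web ι := link (gap x) (index ⟦x⟧) (pos x)
  have hlink (x y) : link' x ≤ link' y ↔ x.1 ≤ y.1 := by
    rw [(hgap x).le_iff_irredBelow_or hr (hgap y), link_le_link, hindex.eq_iff, Quotient.eq,
      ← irredBelow_iff_of_strictMono hpos]
    refine or_congr_left ⟨And.right, fun h => ⟨?_, h⟩⟩
    exact (hgap x).eq_of_irredBelow (fun v => (hr _).2 ⟨v, rfl⟩) (hgap y) h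
  have hf (x : α) : ∃ y, (∀ v, r v = x → y = node v) ∧ ∀ h : ¬ IsReducible x, y = link' ⟨x, h⟩ := by
    by_cases hx : IsReducible x
    · obtain ⟨v, rfl⟩ := (hr x).1 hx
      exact ⟨node v, fun w hw => congrArg node (r.injective hw).symm, fun h => absurd hx h⟩
    · exact ⟨link' ⟨x, hx⟩, fun v hv => absurd ((hr x).2 ⟨v, hv⟩) hx, fun _ => rfl⟩
  choose f hnode hirr using hf
  refine ⟨OrderEmbedding.ofMapLEIff f fun x y => ?_, fun v => hnode _ v rfl⟩
  rcases em (IsReducible x) with hx | hx <;> rcases em (IsReducible y) with hy | hy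
  · obtain ⟨⟨v, rfl⟩, w, rfl⟩ := And.intro ((hr x).1 hx) ((hr y).1 hy)
    rw [hnode _ v rfl, hnode _ w rfl, node_le_node, r.le_iff_le]
  · obtain ⟨v, rfl⟩ := (hr x).1 hx
    rw [hnode _ v rfl, hirr y hy, node_le_link, (hgap ⟨y, hy⟩).le_iff]
  · obtain ⟨w, rfl⟩ := (hr y).1 hy
    rw [hirr x hx, hnode _ w rfl, link_le_node, (hgap ⟨x, hx⟩).ge_iff]
  · rw [hirr x hx, hirr y hy, hlink]

end Strands

section Embed

open Web

variable {ι α : Type*} [LinearOrder ι] [Fintype ι] [Lattice α] [Finite α] {r : ι ↪o α}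

theorem reduced_of_isRed_node {X : Finset (Web ι)} (hX : ∀ v, node v ∈ X)
    (h : ∀ v, IsRed (⟨node v, hX v⟩ : X)) : Reduced X where
  node_mem := hX
  isSpanning v := by
    have hv := h v
    rw [IsRed, IsIrr, subsingleton_lowerCovers_node_iff hX, subsingleton_upperCovers_node_iff hX,
      not_and_or] at hv
    push Not at hv
    rcases hv with ⟨q, hq, he⟩ | ⟨q, hq, he⟩
    exacts [⟨q, .inr hq, he⟩, ⟨q, .inl hq, he⟩]

theorem exists_hasExcess_of_isBlock (hb : IsBlock α)
    (hr : ∀ a, IsReducible a ↔ a ∈ Set.range r) : ∃ e : Gap ι → ℕ, HasExcess α e := by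
  classical
  obtain ⟨⟨t, ht, htr⟩, b, hb, hbr⟩ := hb
  obtain ⟨vt, rfl⟩ := (hr t).1 (.inr htr)
  obtain ⟨vb, rfl⟩ := (hr b).1 (.inl hbr)
  obtain ⟨f, hf⟩ := exists_orderEmbedding_web hr (fun x => ⟨vb, hb x⟩) fun x => ⟨vt, ht x⟩
  have := Fintype.ofFinite α
  let X : Finset (Web ι) := (Set.range f).toFinset
  have hX (v : ι) : node v ∈ X := Set.mem_toFinset.2 ⟨r v, hf v⟩
  let g : α ≃o X :=
    f.orderIso.trans (OrderIso.setCongr _ (X : Set (Web ι)) (Set.coe_toFinset _).symm)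
  have hg (v : ι) : g (r v) = ⟨node v, hX v⟩ := Subtype.ext (hf v)
  refine ⟨_, X, reduced_of_isRed_node hX fun v => ?_, rfl, ⟨g⟩⟩
  rw [← hg, isRed_orderIso_iff, ← isReducible_iff_isRed, hr]
  exact ⟨v, rfl⟩

end Embed

/-! ### Realizing strand sizes by a block -/

theorem exists_eq_map_range {α : Type*} [Inhabited α] (s : Multiset α) :
    ∃ f : ℕ → α, s = (Multiset.range (Multiset.card s)).map f := by
  induction s using Quotient.inductionOn with
  | h l =>
    refine ⟨fun i => l.getD i default, congrArg _ (List.ext_getElem (by simp) fun i hi _ => ?_)⟩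
    simp [hi]

theorem exists_lattice_orderIso {α β : Type*} [PartialOrder β] (g : α ≃ β)
    (hsup : ∀ x y : β, ∃ z, IsLUB {x, y} z) (hinf : ∀ x y : β, ∃ z, IsGLB {x, y} z) :
    ∃ L : Lattice α, Nonempty (@OrderIso α β L.toLE _) := by
  let _ : PartialOrder α := PartialOrder.lift g g.injective
  let e : α ≃o β := ⟨g, Iff.rfl⟩
  choose sup hsup using hsup
  choose inf hinf using hinf
  refine ⟨Lattice.ofIsLUBofIsGLB (fun a b => e.symm (sup (e a) (e b)))
    (fun a b => e.symm (inf (e a) (e b))) (fun a b => ?_) fun a b => ?_, ⟨e⟩⟩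
  · rw [← e.isLUB_image, Set.image_pair]
    exact hsup _ _
  · rw [← e.isGLB_image, Set.image_pair]
    exact hinf _ _

namespace Web

variable {ι : Type*} [LinearOrder ι] {X : Finset (Web ι)}

theorem exists_forall_link_mem_iff [Finite ι] (n : Gap ι → ℕ) (len : Gap ι → ℕ → ℕ) :
    ∃ X : Finset (Web ι), (∀ v, node v ∈ X) ∧
      ∀ {q i p}, link q i p ∈ X ↔ i < n q ∧ p < len q i := by
  have := Fintype.ofFinite ι
  refine ⟨Finset.univ.image node ∪
    (Finset.univ.sigma fun q => (Finset.range (n q)).sigma fun i => Finset.range (len q i)).image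
      fun l => link l.1 l.2.1 l.2.2, fun v => by simp, fun {q i p} => ?_⟩
  simp only [Finset.mem_union, Finset.mem_image, Finset.mem_sigma, Finset.mem_range,
    Finset.mem_univ, true_and, reduceCtorEq, exists_false, false_or]
  constructor
  · rintro ⟨⟨q', i', p'⟩, h, hl⟩
    obtain ⟨rfl, rfl, rfl⟩ := link.inj hl
    exact h
  · exact fun h => ⟨⟨q, i, p⟩, h, rfl⟩

theorem exists_sizes_eq [Finite ι] {F : Gap ι → Multiset ℕ} (hF : ∀ q, 0 ∉ F q) :
    ∃ X : Finset (Web ι), (∀ v, node v ∈ X) ∧ sizes X = F := by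
  choose len hlen using fun q => exists_eq_map_range (F q)
  obtain ⟨X, hnode, hX⟩ := exists_forall_link_mem_iff (fun q => Multiset.card (F q)) len
  have hpos {q i} (hi : i < Multiset.card (F q)) : 0 < len q i := by
    refine Nat.pos_of_ne_zero fun h => hF q ?_
    rw [hlen q, ← h]
    exact Multiset.mem_map_of_mem _ (Multiset.mem_range.2 hi)
  refine ⟨X, hnode, funext fun q => ?_⟩
  have hstrands : strands X q = Finset.range (Multiset.card (F q)) := by
    ext i
    rw [mem_strands, Finset.mem_range]
    exact ⟨fun ⟨_, h⟩ => (hX.1 h).1, fun h => ⟨0, hX.2 ⟨h, hpos h⟩⟩⟩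
  rw [sizes, hstrands]
  refine Eq.trans (Multiset.map_congr rfl fun i hi => ?_) (hlen q).symm
  have hstrand : strand X q i = Finset.range (len q i) := by
    ext p
    rw [mem_strand, Finset.mem_range, hX, and_iff_right (Multiset.mem_range.1 hi)]
  rw [hstrand, Finset.card_range]

/-- The least node above an element. -/
def upper : Web ι → ι
  | node v => v
  | link q _ _ => q.tgt

/-- The greatest node below an element. -/
def lower : Web ι → ι
  | node v => v
  | link q _ _ => q.src

theorem le_node_iff {x : Web ι} {v : ι} : x ≤ node v ↔ x.upper ≤ v := by cases x <;> rfl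

theorem node_le_iff {x : Web ι} {v : ι} : node v ≤ x ↔ v ≤ x.lower := by cases x <;> rfl

theorem upper_le_lower_of_le {x y z : Web ι} (hx : x ≤ z) (hy : y ≤ z) (hxy : ¬ x ≤ y)
    (hyx : ¬ y ≤ x) : max x.upper y.upper ≤ z.lower := by
  have hlt := Gap.lt (ι := ι)
  rcases x with u | ⟨q, i, p⟩ <;> rcases y with v | ⟨q', i', p'⟩ <;>
    rcases z with w | ⟨q'', i'', p''⟩ <;>
    simp only [link_le_link, node_le_node, node_le_link, link_le_node, upper, lower] at * <;>
    grind

theorem upper_le_lower_of_ge {x y z : Web ι} (hx : z ≤ x) (hy : z ≤ y) (hxy : ¬ x ≤ y)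
    (hyx : ¬ y ≤ x) : z.upper ≤ min x.lower y.lower := by
  have hlt := Gap.lt (ι := ι)
  rcases x with u | ⟨q, i, p⟩ <;> rcases y with v | ⟨q', i', p'⟩ <;>
    rcases z with w | ⟨q'', i'', p''⟩ <;>
    simp only [link_le_link, node_le_node, node_le_link, link_le_node, upper, lower] at * <;>
    grind

theorem exists_isLUB_pair (hX : ∀ v, node v ∈ X) (x y : X) : ∃ z, IsLUB {x, y} z := by
  by_cases hxy : x ≤ y
  · exact ⟨y, IsGreatest.isLUB ⟨by simp, by simp [upperBounds, hxy]⟩⟩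
  by_cases hyx : y ≤ x
  · exact ⟨x, IsGreatest.isLUB ⟨by simp, by simp [upperBounds, hyx]⟩⟩
  refine ⟨⟨node (max x.1.upper y.1.upper), hX _⟩, ?_, fun z hz => node_le_iff.2 ?_⟩
  · rintro z (rfl | rfl)
    exacts [le_node_iff.2 (le_max_left _ _), le_node_iff.2 (le_max_right _ _)]
  · exact upper_le_lower_of_le (hz (.inl rfl)) (hz (.inr rfl)) hxy hyx

theorem exists_isGLB_pair (hX : ∀ v, node v ∈ X) (x y : X) : ∃ z, IsGLB {x, y} z := by
  by_cases hxy : x ≤ y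
  · exact ⟨x, IsLeast.isGLB ⟨by simp, by simp [lowerBounds, hxy]⟩⟩
  by_cases hyx : y ≤ x
  · exact ⟨y, IsLeast.isGLB ⟨by simp, by simp [lowerBounds, hyx]⟩⟩
  refine ⟨⟨node (min x.1.lower y.1.lower), hX _⟩, ?_, fun z hz => le_node_iff.2 ?_⟩
  · rintro z (rfl | rfl)
    exacts [node_le_iff.2 (min_le_left _ _), node_le_iff.2 (min_le_right _ _)]
  · exact upper_le_lower_of_ge (hz (.inl rfl)) (hz (.inr rfl)) hxy hyx

theorem exists_lattice_fin_orderIso (hX : ∀ v, node v ∈ X) {j : ℕ} (hj : X.card = j) :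
    ∃ L : Lattice (Fin j), Nonempty (@OrderIso (Fin j) X L.toLE _) :=
  exists_lattice_orderIso (X.equivFinOfCardEq hj).symm (exists_isLUB_pair hX)
    (exists_isGLB_pair hX)

end Web

/-! ### Blocks with a chain of reducible elements -/

section Block

open Web

variable {ι α : Type*} [LinearOrder ι] [Fintype ι] [Lattice α] {e : Gap ι → ℕ}

theorem Web.HasExcess.exists_orderEmbedding (h : HasExcess α e) :
    ∃ r : ι ↪o α, (∀ a, IsReducible a ↔ a ∈ Set.range r) ∧ (∀ x, ∃ v, r v ≤ x) ∧
      ∀ x, ∃ v, x ≤ r v := by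
  obtain ⟨X, hX, -, ⟨g⟩⟩ := h
  have : Finite α := Finite.of_equiv _ g.symm.toEquiv
  let r : ι ↪o X := OrderEmbedding.ofMapLEIff (fun v => ⟨node v, hX.node_mem v⟩) fun _ _ => Iff.rfl
  refine ⟨r.trans g.symm.toOrderEmbedding, fun a => ?_, fun x => ⟨(g x).1.lower, ?_⟩,
    fun x => ⟨(g x).1.upper, ?_⟩⟩
  · rw [isReducible_iff_isRed, ← isRed_orderIso_iff g, hX.isRed_iff]
    refine exists_congr fun v => ?_
    change _ ↔ g.symm (r v) = a
    rw [g.symm_apply_eq, eq_comm, Subtype.ext_iff]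
    rfl
  · exact g.symm_apply_le.2 (node_le_iff.2 le_rfl)
  · exact g.le_symm_apply.2 (le_node_iff.2 le_rfl)

theorem Web.HasExcess.isRCBlock [BoundedOrder ι] (h : HasExcess α e) :
    IsRCBlock α (Fintype.card ι) (∑ q, e q) := by
  obtain ⟨r, hr, hlower, hupper⟩ := h.exists_orderEmbedding
  have hrange : {a : α | IsReducible a} = Set.range r := Set.ext hr
  have htop : IsTop (r ⊤) := fun x => (hupper x).elim fun _ hx => hx.trans (r.monotone le_top)
  have hbot : IsBot (r ⊥) := fun x => (hlower x).elim fun _ hx => (r.monotone bot_le).trans hx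
  refine ⟨⟨⟨_, htop, ?_⟩, _, hbot, ?_⟩, ?_, ?_, h.nullity_eq⟩
  · exact (isJoinReducible_iff_isReducible_of_isTop htop).2 ((hr _).2 ⟨_, rfl⟩)
  · exact (isMeetReducible_iff_isReducible_of_isBot hbot).2 ((hr _).2 ⟨_, rfl⟩)
  · rw [hrange, ← Set.image_univ, Set.ncard_image_of_injective _ r.injective, Set.ncard_univ,
      Nat.card_eq_fintype_card]
  · rw [hrange]
    exact r.monotone.isChain_range

theorem isRCBlock_iff_exists_hasExcess [Finite α] {n k : ℕ} [NeZero n] :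
    IsRCBlock α n k ↔ ∃ e : Gap (Fin n) → ℕ, HasExcess α e ∧ ∑ q, e q = k := by
  constructor
  · rintro ⟨hb, rfl, hc, hk⟩
    obtain ⟨r, hr⟩ := exists_orderEmbedding_fin_of_isChain hc (Set.toFinite _)
    obtain ⟨e, he⟩ := exists_hasExcess_of_isBlock hb (r := r) fun a => (Set.ext_iff.1 hr a).symm
    exact ⟨e, he, by exact_mod_cast he.nullity_eq.symm.trans hk⟩
  · rintro ⟨e, he, rfl⟩
    simpa using he.isRCBlock

end Block

/-! ### The nine basic blocks of height four in the web over four nodes -/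

theorem exists_eq_card_fiber {κ : Type*} [Fintype κ] [DecidableEq κ] {e : κ → ℕ} {n : ℕ}
    (h : ∑ q, e q = n) : ∃ g : Fin n → κ, e = fun q => Finset.card {k | g k = q} := by
  obtain ⟨f⟩ : Nonempty (Fin n ≃ Σ q, Fin (e q)) := Fintype.card_eq.1 (by simp [h])
  refine ⟨fun k => (f k).1, funext fun q => ?_⟩
  rw [← Fintype.card_subtype, ← Fintype.card_fin (e q)]
  exact Fintype.card_congr
    ((f.subtypeEquiv fun _ => Iff.rfl).trans (Equiv.sigmaSubtype q)).symm

namespace HeightFourBlock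

open Web

/-- The chain element of `B_{i+4}` that is not reducible is the one between the `midNode i`-th
node and its successor. -/
def midNode : Fin 9 → Fin 3 := ![1, 1, 2, 0, 2, 0, 1, 1, 1]

/-- The gap over which the irreducible chain element lies. -/
def midGap (i : Fin 9) : Gap (Fin 4) :=
  ⟨(midNode i).castSucc, (midNode i).succ, Fin.castSucc_lt_succ⟩

/-- The pairs of nodes that the extra elements are adjoined to. -/
def extraGap (i : Fin 9) (k : Fin 3) : Gap (Fin 4) where
  src := (midNode i).succ.predAbove (adjunctPairs i k).1
  tgt := (midNode i).succ.predAbove (adjunctPairs i k).2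
  lt := by revert i k; decide

/-- The position in the web of a chain element. -/
def chainToWeb (i : Fin 9) (u : Fin 5) : Web (Fin 4) :=
  if u = (midNode i).succ.castSucc then link (midGap i) 0 0
  else node ((midNode i).succ.predAbove u)

/-- The position in the web of an extra element, on a strand of its own. -/
def extraToWeb (i : Fin 9) (k : Fin 3) : Web (Fin 4) := link (extraGap i k) (k + 1) 0

/-- The part of the web over four nodes that is isomorphic to `B_{i+4}`. -/
def image (i : Fin 9) : Finset (Web (Fin 4)) :=
  Finset.univ.image (chainToWeb i) ∪ Finset.univ.image (extraToWeb i)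

theorem chainToWeb_le_chainToWeb : ∀ i u v, chainToWeb i u ≤ chainToWeb i v ↔ u ≤ v := by decide

theorem chainToWeb_le_extraToWeb :
    ∀ i u k, chainToWeb i u ≤ extraToWeb i k ↔ u ≤ (adjunctPairs i k).1 := by decide

theorem extraToWeb_le_chainToWeb :
    ∀ i k v, extraToWeb i k ≤ chainToWeb i v ↔ (adjunctPairs i k).2 ≤ v := by decide

theorem extraToWeb_le_extraToWeb : ∀ i k l, extraToWeb i k ≤ extraToWeb i l ↔
    k = l ∨ (adjunctPairs i k).2 ≤ (adjunctPairs i l).1 := by decide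

theorem nonempty_orderIso_image (i : Fin 9) : Nonempty (HeightFourBlock i ≃o image i) := by
  let toImage : HeightFourBlock i → image i
    | chain u => ⟨chainToWeb i u, by simp [image]⟩
    | extra k => ⟨extraToWeb i k, by simp [image]⟩
  refine ⟨RelIso.ofSurjective (OrderEmbedding.ofMapLEIff toImage ?_) ?_⟩
  · rintro (u | k) (v | l)
    · exact chainToWeb_le_chainToWeb i u v
    · exact chainToWeb_le_extraToWeb i u l
    · exact extraToWeb_le_chainToWeb i k v
    · exact extraToWeb_le_extraToWeb i k l
  · rintro ⟨x, hx⟩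
    simp only [image, Finset.mem_union, Finset.mem_image, Finset.mem_univ, true_and] at hx
    obtain ⟨u, rfl⟩ | ⟨k, rfl⟩ := hx
    exacts [⟨chain u, rfl⟩, ⟨extra k, rfl⟩]

/-- The excess of `B_{i+4}`: each extra element contributes one to the gap it lies over. -/
def excessType (i : Fin 9) (q : Gap (Fin 4)) : ℕ := Finset.card {k | extraGap i k = q}

theorem excessType_injective : Function.Injective excessType := by decide

theorem sum_excessType (i : Fin 9) : ∑ q, excessType i q = 3 :=
  (Finset.card_eq_sum_card_fiberwise (f := extraGap i) (s := .univ) (t := .univ)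
    fun _ _ => Finset.mem_univ _).symm

theorem isSpanning_excessType : ∀ i, IsSpanning (excessType i) := by
  unfold IsSpanning; decide

theorem node_mem_image : ∀ i v, node v ∈ image i := by decide

theorem sizes_image (i : Fin 9) :
    sizes (image i) = fun q => Multiset.replicate (basicWidth (excessType i) q) 1 := by
  funext q; revert i q; decide

theorem hasExcess (i : Fin 9) : HasExcess (HeightFourBlock i) (excessType i) := by
  have hexcess : excess (width (image i)) = excessType i := by
    rw [width_eq_card_sizes, sizes_image]
    simp only [Multiset.card_replicate, excess_basicWidth]
  exact ⟨image i, ⟨node_mem_image i, hexcess ▸ isSpanning_excessType i⟩, hexcess,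
    nonempty_orderIso_image i⟩

theorem exists_eq_excessType_iff {e : Gap (Fin 4) → ℕ} (he : IsSpanning e) (hsum : ∑ q, e q = 3) :
    (∃ i, e = excessType i) ↔ (occupied e).card = 1 := by
  obtain ⟨g, rfl⟩ := exists_eq_card_fiber hsum
  -- Three units of excess are distributed over six gaps, so there are only `6 ^ 3` cases.
  revert g
  unfold IsSpanning
  decide +kernel

end HeightFourBlock

namespace Web

section Invariants

variable {ι α β : Type*} [LinearOrder ι] [Fintype ι] [PartialOrder α] [PartialOrder β]
  {X Y : Finset (Web ι)} {e e' : Gap ι → ℕ}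

theorem nonempty_orderIso_iff_sizes_eq (hX : Reduced X) (hY : Reduced Y) (f : α ≃o X)
    (g : β ≃o Y) : Nonempty (α ≃o β) ↔ sizes X = sizes Y := by
  constructor
  · rintro ⟨h⟩
    exact hX.sizes_eq_of_orderIso hY ((f.symm.trans h).trans g)
  · intro h
    obtain ⟨k⟩ := nonempty_orderIso_of_sizes_eq hX.node_mem hY.node_mem h
    exact ⟨(f.trans k).trans g.symm⟩

theorem HasExcess.of_orderIso (h : HasExcess α e) (f : α ≃o β) : HasExcess β e := by
  obtain ⟨X, hX, he, ⟨g⟩⟩ := h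
  exact ⟨X, hX, he, ⟨f.symm.trans g⟩⟩

theorem HasExcess.unique (h : HasExcess α e) (h' : HasExcess α e') : e = e' := by
  obtain ⟨X, hX, rfl, ⟨g⟩⟩ := h
  obtain ⟨Y, hY, rfl, ⟨g'⟩⟩ := h'
  have hs := (nonempty_orderIso_iff_sizes_eq hX hY g g').1 ⟨.refl α⟩
  rw [width_eq_card_sizes, hs, width_eq_card_sizes]

theorem HasExcess.isSpanning (h : HasExcess α e) : IsSpanning e := by
  obtain ⟨X, hX, rfl, -⟩ := h
  exact hX.isSpanning

theorem HasExcess.hasBasicBlockOfHeight_iff [Nonempty ι] (h : HasExcess α e) {n : ℕ} :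
    HasBasicBlockOfHeight α n ↔ Fintype.card ι - 1 + (occupied e).card = n := by
  have hheight {B : Set α} (hB : IsAssociatedBasicBlock B) :
      Order.krullDim B = (n : WithBot ℕ∞) ↔ Fintype.card ι - 1 + (occupied e).card = n := by
    rw [h.krullDim_basicBlock hB]
    norm_cast
  constructor
  · rintro ⟨B, hB, hn⟩
    exact (hheight hB).1 hn
  · intro hn
    obtain ⟨B, hB⟩ := h.exists_isAssociatedBasicBlock
    exact ⟨B, hB, (hheight hB).2 hn⟩

theorem HasExcess.hasBasicBlock_iff {e : Gap (Fin 4) → ℕ} (h : HasExcess α e) {i : Fin 9} :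
    HasBasicBlock α (HeightFourBlock i) ↔ e = HeightFourBlock.excessType i := by
  constructor
  · rintro ⟨B, hB, ⟨g⟩⟩
    have hBe := h.of_isAssociatedBasicRetract (h.isAssociatedBasicBlock_iff.1 hB)
    exact (hBe.of_orderIso g).unique (HeightFourBlock.hasExcess i)
  · rintro rfl
    obtain ⟨B, hB⟩ := h.exists_isAssociatedBasicBlock
    obtain ⟨Y, hY, hs, ⟨f⟩⟩ := h.exists_orderIso_basicBlock hB
    obtain ⟨g⟩ := HeightFourBlock.nonempty_orderIso_image i
    obtain ⟨k⟩ := nonempty_orderIso_of_sizes_eq hY (HeightFourBlock.node_mem_image i)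
      (hs.trans (HeightFourBlock.sizes_image i).symm)
    exact ⟨B, hB, ⟨(f.trans k).trans g.symm⟩⟩

end Invariants

/-! ### Isomorphism classes and families of strand sizes -/

section Classes

variable {ι : Type*} [LinearOrder ι] [Fintype ι] {e e' : Gap ι → ℕ} {j : ℕ}
  {F : Gap ι → Multiset ℕ}

/-- The isomorphism classes of lattices on `j` elements of the given excess. -/
def excessClass (e : Gap ι → ℕ) (j : ℕ) : Set (LatticeClass j) :=
  Quotient.mk (latticeSetoid j) '' {L | @HasExcess ι _ _ (Fin j) L.toPartialOrder e}

/-- The families of multisets of strand sizes of the lattices on `j` elements of excess `e`. -/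
def sizeFamilies (e : Gap ι → ℕ) (j : ℕ) : Set (Gap ι → Multiset ℕ) :=
  {F | (∀ q, 0 ∉ F q) ∧ (excess fun q => Multiset.card (F q)) = e ∧
    Fintype.card ι + ∑ q, (F q).sum = j}

theorem sizes_mem_sizeFamilies_iff {X : Finset (Web ι)} (hX : ∀ v, node v ∈ X) :
    sizes X ∈ sizeFamilies e j ↔ excess (width X) = e ∧ X.card = j := by
  rw [card_eq_card_add_sum_sizes hX, width_eq_card_sizes]
  exact and_iff_right fun _ => zero_notMem_sizes

theorem exists_lattice_of_mem_sizeFamilies (he : IsSpanning e) (hF : F ∈ sizeFamilies e j) :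
    ∃ (L : Lattice (Fin j)) (X : Finset (Web ι)), Reduced X ∧ sizes X = F ∧
      Nonempty (@OrderIso (Fin j) X L.toLE _) := by
  obtain ⟨X, hX, rfl⟩ := exists_sizes_eq hF.1
  obtain ⟨rfl, hj⟩ := (sizes_mem_sizeFamilies_iff hX).1 hF
  obtain ⟨L, hL⟩ := exists_lattice_fin_orderIso hX hj
  exact ⟨L, X, ⟨hX, he⟩, rfl, hL⟩

theorem exists_bijOn_excessClass (he : IsSpanning e) (j : ℕ) :
    ∃ c, Set.BijOn c (sizeFamilies e j) (excessClass e j) := by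
  have : Nonempty (Lattice (Fin j)) := ⟨inferInstance⟩
  choose! L X hX hsizes hiso using
    fun F (hF : F ∈ sizeFamilies e j) => exists_lattice_of_mem_sizeFamilies he hF
  refine ⟨fun F => Quotient.mk _ (L F), fun F hF => ?_, fun F hF F' hF' h => ?_, ?_⟩
  · have hF' := hF
    rw [← hsizes F hF, sizes_mem_sizeFamilies_iff (hX F hF).node_mem] at hF'
    exact ⟨L F, ⟨X F, hX F hF, hF'.1, hiso F hF⟩, rfl⟩
  · obtain ⟨f⟩ := hiso F hF
    obtain ⟨g⟩ := hiso F' hF'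
    rw [← hsizes F hF, ← hsizes F' hF']
    exact (@nonempty_orderIso_iff_sizes_eq _ _ _ _ _ (L F).toPartialOrder (L F').toPartialOrder
      _ _ (hX F hF) (hX F' hF') f g).1 (Quotient.exact h)
  · rintro _ ⟨M, ⟨Y, hY, rfl, ⟨g⟩⟩, rfl⟩
    have hF : sizes Y ∈ sizeFamilies (excess (width Y)) j :=
      (sizes_mem_sizeFamilies_iff hY.node_mem).2
        ⟨rfl, by simpa using (Fintype.card_congr g.toEquiv).symm⟩
    obtain ⟨f⟩ := hiso _ hF
    exact ⟨_, hF, Quotient.sound ((@nonempty_orderIso_iff_sizes_eq _ _ _ _ _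
      (L _).toPartialOrder M.toPartialOrder _ _ (hX _ hF) hY f g).2 (hsizes _ hF))⟩

theorem ncard_excessClass (he : IsSpanning e) :
    (excessClass e j).ncard = (sizeFamilies e j).ncard := by
  obtain ⟨c, hc⟩ := exists_bijOn_excessClass he j
  rw [← hc.image_eq, hc.injOn.ncard_image]

theorem disjoint_excessClass (h : e ≠ e') : Disjoint (excessClass e j) (excessClass e' j) := by
  rw [Set.disjoint_left]
  rintro _ ⟨L, hL, rfl⟩ ⟨M, hM, hML⟩
  obtain ⟨f⟩ := Quotient.exact hML
  exact h (@HasExcess.unique _ _ _ _ L.toPartialOrder _ _ hL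
    (@HasExcess.of_orderIso _ _ _ _ _ M.toPartialOrder L.toPartialOrder _ hM f))

end Classes

end Web

section FourNodes

open Web HeightFourBlock

variable {α : Type*} [Lattice α] [Finite α]

theorem isRCBlock_and_hasBasicBlock_iff {i : Fin 9} :
    IsRCBlock α 4 3 ∧ HasBasicBlock α (HeightFourBlock i) ↔ HasExcess α (excessType i) := by
  rw [isRCBlock_iff_exists_hasExcess]
  constructor
  · rintro ⟨⟨e, he, -⟩, hB⟩
    exact he.hasBasicBlock_iff.1 hB ▸ he
  · exact fun h => ⟨⟨_, h, sum_excessType i⟩, h.hasBasicBlock_iff.2 rfl⟩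

theorem isRCBlock_and_hasBasicBlockOfHeight_iff :
    IsRCBlock α 4 3 ∧ HasBasicBlockOfHeight α 4 ↔ ∃ i, HasExcess α (excessType i) := by
  simp only [← isRCBlock_and_hasBasicBlock_iff, exists_and_left]
  refine and_congr_right fun h => ?_
  obtain ⟨e, he, hsum⟩ := isRCBlock_iff_exists_hasExcess.1 h
  rw [he.hasBasicBlockOfHeight_iff, exists_congr fun i => he.hasBasicBlock_iff,
    exists_eq_excessType_iff he.isSpanning hsum, Fintype.card_fin]
  omega

theorem typedBlockClass_eq_excessClass (i : Fin 9) (j : ℕ) :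
    typedBlockClass i j = excessClass (excessType i) j :=
  congrArg _ (Set.ext fun L => @isRCBlock_and_hasBasicBlock_iff (Fin j) L _ i)

theorem blockClass_eq_iUnion (j : ℕ) : blockClass j 4 3 4 = ⋃ i, typedBlockClass i j := by
  have h : {L | @IsRCBlock (Fin j) L 4 3 ∧ @HasBasicBlockOfHeight (Fin j) L.toPartialOrder 4} =
      ⋃ i, {L | @HasExcess (Fin 4) _ _ (Fin j) L.toPartialOrder (excessType i)} := by
    ext L
    rw [Set.mem_iUnion]
    exact @isRCBlock_and_hasBasicBlockOfHeight_iff (Fin j) L _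
  simp only [typedBlockClass_eq_excessClass, excessClass]
  exact (congrArg _ h).trans Set.image_iUnion

end FourNodes

/-! ### Counting families of partitions -/

section Counting

open PowerSeries

/-- The generating function of the partitions whose number of parts satisfies `P`. -/
def partitionSeries (P : ℕ → Prop) [DecidablePred P] : ℕ⟦X⟧ :=
  mk fun n => Finset.card {p : n.Partition | P (Multiset.card p.parts)}

/-- The generating function of the partitions into exactly `k` parts. -/
def partSeries (k : ℕ) : ℕ⟦X⟧ := mk (numPartitions k)

/-- The multisets of parts of the partitions of `n` whose number of parts satisfies `P`. -/
def partMultisets (P : ℕ → Prop) [DecidablePred P] (n : ℕ) : Finset (Multiset ℕ) :=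
  Finset.map ⟨Nat.Partition.parts, fun _ _ => Nat.Partition.ext⟩
    {p : n.Partition | P (Multiset.card p.parts)}

theorem mem_partMultisets {P : ℕ → Prop} [DecidablePred P] {n : ℕ} {m : Multiset ℕ} :
    m ∈ partMultisets P n ↔ 0 ∉ m ∧ P (Multiset.card m) ∧ m.sum = n := by
  simp only [partMultisets, Finset.mem_map, Finset.mem_filter, Finset.mem_univ, true_and]
  constructor
  · rintro ⟨p, hp, rfl⟩
    exact ⟨fun h => (p.parts_pos h).ne rfl, hp, p.parts_sum⟩
  · rintro ⟨h0, hp, hs⟩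
    exact ⟨⟨m, fun hi => Nat.pos_of_ne_zero (ne_of_mem_of_not_mem hi h0), hs⟩, hp, rfl⟩

section Families

variable {κ : Type*} [Fintype κ] [DecidableEq κ] (P : κ → ℕ → Prop) [∀ q, DecidablePred (P q)]

/-- The families of multisets of positive integers of total sum `n` in which the cardinality of
the `q`-th multiset satisfies `P q`. -/
def partFamilies (n : ℕ) : Finset (κ → Multiset ℕ) :=
  (Finset.univ.finsuppAntidiag n).biUnion fun a =>
    Fintype.piFinset fun q => partMultisets (P q) (a q)

variable {P} in
theorem mem_partFamilies {n : ℕ} {F : κ → Multiset ℕ} : F ∈ partFamilies P n ↔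
    (∀ q, 0 ∉ F q) ∧ (∀ q, P q (Multiset.card (F q))) ∧ ∑ q, (F q).sum = n := by
  simp only [partFamilies, Finset.mem_biUnion, Finset.mem_finsuppAntidiag, Fintype.mem_piFinset,
    mem_partMultisets]
  constructor
  · rintro ⟨a, ⟨ha, -⟩, h⟩
    exact ⟨fun q => (h q).1, fun q => (h q).2.1,
      ha ▸ Finset.sum_congr rfl fun q _ => (h q).2.2⟩
  · rintro ⟨h0, hp, hs⟩
    exact ⟨Finsupp.equivFunOnFinite.symm fun q => (F q).sum, ⟨by simpa using hs, by simp⟩,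
      fun q => ⟨h0 q, hp q, by simp⟩⟩

theorem card_partFamilies (n : ℕ) :
    (partFamilies P n).card = coeff n (∏ q, partitionSeries (P q)) := by
  rw [partFamilies, Finset.card_biUnion, coeff_prod]
  · simp only [Fintype.card_piFinset, partMultisets, Finset.card_map, partitionSeries, coeff_mk]
  · intro a _ b _ hab
    rw [Function.onFun, Finset.disjoint_left]
    intro F ha hb
    refine hab (Finsupp.ext fun q => ?_)
    rw [Fintype.mem_piFinset] at ha hb
    rw [← (mem_partMultisets.1 (ha q)).2.2, ← (mem_partMultisets.1 (hb q)).2.2]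

end Families

/-! ### Partitions into few parts -/

theorem partitionSeries_congr {P Q : ℕ → Prop} [DecidablePred P] [DecidablePred Q]
    (h : ∀ c, P c ↔ Q c) : partitionSeries P = partitionSeries Q := by
  simp only [partitionSeries, h]

theorem card_parts_ne_zero {n : ℕ} (hn : n ≠ 0) (p : n.Partition) :
    Multiset.card p.parts ≠ 0 := fun h => hn (by
  rw [← p.parts_sum, Multiset.card_eq_zero.1 h, Multiset.sum_zero])

theorem card_parts_le_one_iff {n : ℕ} {p : n.Partition} :
    Multiset.card p.parts ≤ 1 ↔ p = .indiscrete n := by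
  obtain rfl | hn := eq_or_ne n 0
  · rw [Subsingleton.elim p (.indiscrete 0)]
    exact iff_of_true zero_le_one rfl
  constructor
  · intro h
    obtain ⟨m, hm⟩ := Multiset.card_eq_one.1 (h.antisymm (Nat.pos_of_ne_zero
      (card_parts_ne_zero hn p)))
    have hsum := p.parts_sum
    rw [hm, Multiset.sum_singleton] at hsum
    exact Nat.Partition.ext (by rw [hm, hsum, Nat.Partition.indiscrete_parts hn])
  · rintro rfl
    rw [Nat.Partition.indiscrete_parts hn, Multiset.card_singleton]

theorem partitionSeries_le_one : partitionSeries (· ≤ 1) = mk 1 := by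
  ext n
  simp only [partitionSeries, card_parts_le_one_iff, coeff_mk]
  exact Finset.card_eq_one.2 ⟨.indiscrete n, by ext; simp⟩

theorem partSeries_zero : partSeries 0 = 1 := by
  ext n
  rw [partSeries, coeff_mk, coeff_one]
  split_ifs with hn
  · subst hn
    rfl
  · exact Finset.card_eq_zero.2 (Finset.filter_false_of_mem fun p _ => card_parts_ne_zero hn p)

theorem partSeries_one : partSeries 1 = X * mk 1 := by
  ext n
  cases n with
  | zero => rw [coeff_zero_X_mul, partSeries, coeff_mk]; rfl
  | succ n =>
    rw [coeff_succ_X_mul, coeff_mk, partSeries, coeff_mk, numPartitions]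
    refine Finset.card_eq_one.2 ⟨.indiscrete _, ?_⟩
    ext p
    have := card_parts_ne_zero n.succ_ne_zero p
    rw [Finset.mem_filter, Finset.mem_singleton, ← card_parts_le_one_iff]
    grind

theorem coeff_partSeries (k n : ℕ) : coeff n (partSeries k) = numPartitions k n := coeff_mk _ _

theorem numPartitions_eq_zero_of_lt {k n : ℕ} (h : n < k) : numPartitions k n = 0 := by
  rw [numPartitions, Finset.card_eq_zero, Finset.filter_eq_empty_iff]
  rintro p - rfl
  have hsum := Multiset.card_nsmul_le_sum fun x (hx : x ∈ p.parts) => p.parts_pos hx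
  rw [p.parts_sum, smul_eq_mul] at hsum
  omega

theorem X_pow_dvd_partSeries (k : ℕ) : X ^ k ∣ partSeries k :=
  X_pow_dvd_iff.2 fun n hn => by rw [coeff_partSeries, numPartitions_eq_zero_of_lt hn]

end Counting

namespace Web

open PowerSeries

section Counting

variable {ι : Type*} [LinearOrder ι] [Fintype ι] {e : Gap ι → ℕ} {j : ℕ}

/-- The consecutive gaps without excess. They may carry one strand or none. -/
def vacant (e : Gap ι → ℕ) : Finset (Gap ι) := {q | q.src ⋖ q.tgt ∧ e q = 0}

theorem partitionSeries_excess (e : Gap ι → ℕ) (q : Gap ι) :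
    partitionSeries (fun c => excess (fun _ => c) q = e q) =
      (if q ∈ vacant e then mk 1 else 1) * partSeries (basicWidth e q) := by
  simp only [vacant, Finset.mem_filter, Finset.mem_univ, true_and]
  split_ifs with h
  · rw [basicWidth, if_pos h.2, partSeries_zero, mul_one, ← partitionSeries_le_one]
    refine partitionSeries_congr fun c => ?_
    rw [excess, if_pos h.1]
    omega
  · rw [one_mul, ← show partitionSeries (· = _) = partSeries (basicWidth e q) from rfl]
    refine partitionSeries_congr fun c => ?_
    rw [excess, basicWidth]
    split_ifs <;> grind

theorem sizeFamilies_eq_partFamilies (hj : Fintype.card ι ≤ j) : sizeFamilies e j =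
    ↑(partFamilies (fun q c => excess (fun _ => c) q = e q) (j - Fintype.card ι)) := by
  ext F
  rw [Finset.mem_coe, mem_partFamilies, sizeFamilies, Set.mem_ofPred_eq, funext_iff,
    add_comm, ← eq_tsub_iff_add_eq_of_le hj]
  rfl

theorem finite_sizeFamilies (hj : Fintype.card ι ≤ j) : (sizeFamilies e j).Finite := by
  rw [sizeFamilies_eq_partFamilies hj]
  exact Finset.finite_toSet _

theorem ncard_sizeFamilies (hj : Fintype.card ι ≤ j) :
    (sizeFamilies e j).ncard = coeff (j - Fintype.card ι)
      (mk 1 ^ (vacant e).card * ∏ q, partSeries (basicWidth e q)) := by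
  rw [sizeFamilies_eq_partFamilies hj, Set.ncard_coe_finset, card_partFamilies]
  simp only [partitionSeries_excess, Finset.prod_mul_distrib, Finset.prod_ite_mem,
    Finset.univ_inter, Finset.prod_const]

end Counting

end Web

section Evaluation

open Web HeightFourBlock PowerSeries

variable {j : ℕ}

theorem card_vacant_excessType : ∀ i, (vacant (excessType i)).card = 2 := by decide

theorem map_basicWidth_excessType : ∀ i, Finset.univ.val.map (basicWidth (excessType i)) =
    if i = 0 then {3, 1, 0, 0, 0, 0} else if i = 1 then {2, 2, 0, 0, 0, 0}
    else {2, 1, 1, 0, 0, 0} := by decide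

theorem prod_partSeries_excessType (i : Fin 9) : ∏ q, partSeries (basicWidth (excessType i) q) =
    if i = 0 then partSeries 3 * partSeries 1 else if i = 1 then partSeries 2 ^ 2
    else partSeries 2 * partSeries 1 ^ 2 := by
  rw [Finset.prod_eq_multiset_prod, ← Function.comp_def partSeries, ← Multiset.map_map,
    map_basicWidth_excessType]
  split_ifs <;> simp [partSeries_zero, pow_two]

theorem finite_typedBlockClass (i : Fin 9) (hj : 4 ≤ j) : (typedBlockClass i j).Finite := by
  obtain ⟨c, hc⟩ := exists_bijOn_excessClass (isSpanning_excessType i) j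
  rw [typedBlockClass_eq_excessClass, ← hc.image_eq]
  exact (finite_sizeFamilies (by simpa using hj)).image c

theorem ncard_blockClass (hj : 4 ≤ j) :
    (blockClass j 4 3 4).ncard = ∑ i : Fin 9, (typedBlockClass i j).ncard := by
  have hdisj : Pairwise fun i i' => Disjoint (typedBlockClass i j) (typedBlockClass i' j) := by
    intro i i' h
    simp only [typedBlockClass_eq_excessClass]
    exact disjoint_excessClass (excessType_injective.ne h)
  rw [blockClass_eq_iUnion, ← finsum_eq_sum_of_fintype,
    Set.ncard_iUnion_of_finite (fun i => finite_typedBlockClass i hj) hdisj]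

theorem ncard_typedBlockClass (i : Fin 9) (hj : 4 ≤ j) : (typedBlockClass i j).ncard =
    coeff (j - 4) (mk 1 ^ 2 * ∏ q, partSeries (basicWidth (excessType i) q)) := by
  rw [typedBlockClass_eq_excessClass, ncard_excessClass (isSpanning_excessType i),
    ncard_sizeFamilies (by simpa using hj), card_vacant_excessType, Fintype.card_fin]

theorem sum_ncard_typedBlockClass (hj : 4 ≤ j) : ∑ i, (typedBlockClass i j).ncard =
    coeff (j - 4) (mk 1 ^ 2 * (partSeries 3 * partSeries 1)) +
      coeff (j - 4) (mk 1 ^ 2 * partSeries 2 ^ 2) +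
      7 * coeff (j - 4) (mk 1 ^ 2 * (partSeries 2 * partSeries 1 ^ 2)) := by
  simp only [ncard_typedBlockClass _ hj, prod_partSeries_excessType]
  simp +decide only [Fin.sum_univ_succ, Fin.succ_ne_zero, if_true, if_false]
  rw [Fin.sum_univ_zero]
  ring

/-! ### Evaluation of the coefficients -/

theorem coeff_mk_mul_of_X_pow_dvd {f : ℕ → ℕ} {φ : ℕ⟦X⟧} {a d : ℕ} (hf : ∀ t < a, f t = 0)
    (hφ : X ^ d ∣ φ) (n : ℕ) :
    coeff n (mk f * φ) = ∑ t ∈ Finset.Icc a (n - d), f t * coeff (n - t) φ := by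
  rw [coeff_mul, Finset.Nat.sum_antidiagonal_eq_sum_range_succ_mk]
  simp only [coeff_mk]
  refine (Finset.sum_subset_zero_on_sdiff ?_ ?_ fun _ _ => rfl).symm
  · intro t ht
    rw [Finset.mem_Icc] at ht
    rw [Finset.mem_range]
    omega
  · intro t ht
    simp only [Finset.mem_sdiff, Finset.mem_range, Finset.mem_Icc, not_and, not_le] at ht
    obtain h | h := lt_or_ge t a
    · rw [hf t h, zero_mul]
    · rw [X_pow_dvd_iff.1 hφ _ (by omega), mul_zero]

theorem coeff_partSeries_one_mul {φ : ℕ⟦X⟧} {d : ℕ} (hφ : X ^ d ∣ φ) (n : ℕ) :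
    coeff n (partSeries 1 * φ) = ∑ t ∈ Finset.Icc 1 (n - d), coeff (n - t) φ := by
  have hone : partSeries 1 = mk fun t => if t < 1 then 0 else 1 := by
    ext t
    cases t <;> simp [partSeries_one, coeff_succ_X_mul]
  rw [hone, coeff_mk_mul_of_X_pow_dvd (fun _ ht => if_pos ht) hφ]
  refine Finset.sum_congr rfl fun t ht => ?_
  rw [if_neg (Finset.mem_Icc.1 ht).1.not_gt, one_mul]

theorem X_pow_succ_dvd_partSeries_one_mul {φ : ℕ⟦X⟧} {d : ℕ} (hφ : X ^ d ∣ φ) :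
    X ^ (d + 1) ∣ partSeries 1 * φ := by
  rw [pow_succ', partSeries_one]
  exact mul_dvd_mul (Dvd.intro _ rfl) hφ

theorem mk_one_sq : (mk 1 : ℕ⟦X⟧) ^ 2 = mk fun n => n + 1 := by
  ext n
  simp [pow_two, coeff_mul]

theorem X_mul_mk_one_sq : X * mk 1 ^ 2 = (mk fun n => n : ℕ⟦X⟧) := by
  ext n
  rw [mk_one_sq]
  cases n <;> simp [coeff_succ_X_mul]

theorem partSeries_one_sq : partSeries 1 ^ 2 = mk fun n => n - 1 := by
  rw [partSeries_one, mul_pow, pow_two X, mul_assoc, X_mul_mk_one_sq]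
  ext n
  cases n <;> simp [coeff_succ_X_mul]

theorem coeff_mk_one_sq_mul_partSeries_three_mul_one (hj : 4 ≤ j) :
    coeff (j - 4) (mk 1 ^ 2 * (partSeries 3 * partSeries 1)) =
      ∑ t ∈ Finset.Icc 1 (j - 7), ∑ i ∈ Finset.Icc 2 (j - t - 5),
        (i - 1) * numPartitions 3 (j - t - i - 2) := by
  have h₃ := X_pow_dvd_partSeries 3
  have h₅ : X ^ 5 ∣ (mk fun n => n - 1) * partSeries 3 := by
    rw [← partSeries_one_sq, pow_two, mul_assoc]
    exact X_pow_succ_dvd_partSeries_one_mul (X_pow_succ_dvd_partSeries_one_mul h₃)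
  have hshift : coeff (j - 4) (mk 1 ^ 2 * (partSeries 3 * partSeries 1)) =
      coeff (j - 2) (partSeries 1 * ((mk fun n => n - 1) * partSeries 3)) := by
    rw [show j - 2 = j - 4 + 2 by omega, ← coeff_X_pow_mul _ 2, ← mul_assoc, ← mul_pow,
      ← partSeries_one, partSeries_one_sq, mul_comm (partSeries 3), mul_left_comm]
  rw [hshift, coeff_partSeries_one_mul h₅]
  refine Finset.sum_congr (by grind) fun t _ => ?_
  rw [coeff_mk_mul_of_X_pow_dvd (a := 2) (by omega) h₃]
  refine Finset.sum_congr (by grind) fun i _ => ?_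
  rw [coeff_partSeries, show j - 2 - t - i = j - t - i - 2 by omega]

theorem coeff_mk_one_sq_mul_partSeries_two_sq (hj : 4 ≤ j) :
    coeff (j - 4) (mk 1 ^ 2 * partSeries 2 ^ 2) =
      ∑ p ∈ Finset.Icc 4 (j - 4), ∑ t ∈ Finset.Icc 1 (j - p - 3),
          t * numPartitions 2 (j - p - t - 1) * numPartitions 2 (p - 2) := by
  have h₂ := X_pow_dvd_partSeries 2
  have h₃ : X ^ 3 ∣ (mk fun n => n) * partSeries 2 := by
    rw [← X_mul_mk_one_sq, mul_assoc, pow_succ']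
    exact mul_dvd_mul_left _ (h₂.mul_left _)
  have hshift : coeff (j - 4) (mk 1 ^ 2 * partSeries 2 ^ 2) =
      coeff (j - 1) ((X ^ 2 * partSeries 2) * ((mk fun n => n) * partSeries 2)) := by
    rw [show j - 1 = j - 4 + 3 by omega, ← coeff_X_pow_mul _ 3, ← X_mul_mk_one_sq,
      show X ^ 2 * partSeries 2 * (X * mk 1 ^ 2 * partSeries 2) =
        X ^ 3 * (mk 1 ^ 2 * partSeries 2 ^ 2) by ring]
  have hpart : X ^ 2 * partSeries 2 = mk fun n => numPartitions 2 (n - 2) := by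
    ext n
    rw [coeff_X_pow_mul', coeff_mk, coeff_partSeries, ite_eq_left_iff]
    exact fun h => (numPartitions_eq_zero_of_lt (by omega)).symm
  rw [hshift, hpart, coeff_mk_mul_of_X_pow_dvd (a := 4)
    (fun t ht => numPartitions_eq_zero_of_lt (by omega)) h₃]
  refine Finset.sum_congr (by grind) fun p _ => ?_
  rw [coeff_mk_mul_of_X_pow_dvd (a := 1) (by omega) h₂, Finset.mul_sum]
  refine Finset.sum_congr (by grind) fun t _ => ?_
  rw [coeff_partSeries, show j - 1 - p - t = j - p - t - 1 by omega, mul_comm]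

theorem coeff_mk_one_sq_mul_partSeries_two_mul_one_sq (hj : 4 ≤ j) :
    coeff (j - 4) (mk 1 ^ 2 * (partSeries 2 * partSeries 1 ^ 2)) =
      ∑ t ∈ Finset.Icc 1 (j - 7), ∑ r ∈ Finset.Icc 1 (j - t - 6),
        ∑ l ∈ Finset.Icc 1 (j - t - r - 5), ∑ i ∈ Finset.Icc 1 (j - t - r - l - 4),
          numPartitions 2 (j - t - r - l - i - 2) := by
  have h₂ := X_pow_dvd_partSeries 2
  have h₃ := X_pow_succ_dvd_partSeries_one_mul h₂
  have h₄ := X_pow_succ_dvd_partSeries_one_mul h₃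
  have h₅ := X_pow_succ_dvd_partSeries_one_mul h₄
  have hshift : coeff (j - 4) (mk 1 ^ 2 * (partSeries 2 * partSeries 1 ^ 2)) =
      coeff (j - 2)
        (partSeries 1 * (partSeries 1 * (partSeries 1 * (partSeries 1 * partSeries 2)))) := by
    rw [show j - 2 = j - 4 + 2 by omega, ← coeff_X_pow_mul _ 2, ← mul_assoc, ← mul_pow,
      ← partSeries_one, show partSeries 1 * (partSeries 1 * (partSeries 1 * (partSeries 1 *
        partSeries 2))) = partSeries 1 ^ 2 * (partSeries 2 * partSeries 1 ^ 2) by ring]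
  simp only [hshift, coeff_partSeries_one_mul h₅, coeff_partSeries_one_mul h₄,
    coeff_partSeries_one_mul h₃, coeff_partSeries_one_mul h₂, coeff_partSeries]
  refine Finset.sum_congr (by grind) fun t _ => Finset.sum_congr (by grind) fun r _ =>
    Finset.sum_congr (by grind) fun l _ => Finset.sum_congr (by grind) fun i _ => ?_
  rw [show j - 2 - t - r - l - i = j - t - r - l - i - 2 by omega]

end Evaluation

theorem mainTheorem4 (j : ℕ) (hj : 8 ≤ j) :
    (blockClass j 4 3 4).ncard = ∑ i : Fin 9, (typedBlockClass i j).ncard ∧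
    ∑ i : Fin 9, (typedBlockClass i j).ncard =
      ∑ t ∈ Finset.Icc 1 (j - 7), ∑ i ∈ Finset.Icc 2 (j - t - 5), (i - 1) * numPartitions 3 (j - t - i - 2)
      + ∑ p ∈ Finset.Icc 4 (j - 4), ∑ t ∈ Finset.Icc 1 (j - p - 3),
          t * numPartitions 2 (j - p - t - 1) * numPartitions 2 (p - 2)
      + ∑ t ∈ Finset.Icc 1 (j - 7), ∑ r ∈ Finset.Icc 1 (j - t - 6), ∑ l ∈ Finset.Icc 1 (j - t - r - 5),
          ∑ i ∈ Finset.Icc 1 (j - t - r - l - 4), 7 * numPartitions 2 (j - t - r - l - i - 2) := by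
  have hj₄ : 4 ≤ j := by omega
  refine ⟨ncard_blockClass hj₄, ?_⟩
  simp only [← Finset.mul_sum]
  rw [sum_ncard_typedBlockClass hj₄, coeff_mk_one_sq_mul_partSeries_three_mul_one hj₄,
    coeff_mk_one_sq_mul_partSeries_two_sq hj₄, coeff_mk_one_sq_mul_partSeries_two_mul_one_sq hj₄]
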